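/- Let $(\Omega,\mathcal F_\infty,(\mathcal F_t)_{t\in\mathbb R^+},P)$ be a filtered probability space whose filtration is right continuous and such that $\mathcal F_0$ is the $\sigma$-algebra generated by the $P$-null sets of $\mathcal F_\infty$. Stopping times take values in $[0,\infty]$, and for a stopping time $\tau$ put $\mathcal F_\tau=\{A\in\mathcal F_\infty : A\cap\{\tau\le t\}\in\mathcal F_t\ \text{for all } t\ge 0\}$ and $L^\infty(\mathcal F_\tau)=L^\infty(\Omega,\mathcal F_\tau,P)$. Relations between elements of these spaces are understood $P$-a.s. A dynamic risk measure is a family of maps $\rho_{\sigma,\tau}:L^\infty(\mathcal F_\tau)\to L^\infty(\mathcal F_\sigma)$, indexed by the pairs of stopping times $\sigma\le\tau$, such that for all $X,Y\in L^\infty(\mathcal F_\tau)$, $Z\in L^\infty(\mathcal F_\sigma)$ and $\lambda\in[0,1]$: if $X\le Y$ then $\rho_{\sigma,\tau}(X)\ge\rho_{\sigma,\tau}(Y)$; $\rho_{\sigma,\tau}(X+Z)=\rho_{\sigma,\tau}(X)-Z$; and $\rho_{\sigma,\tau}(\lambda X+(1-\lambda)Y)\le\lambda\rho_{\sigma,\tau}(X)+(1-\lambda)\rho_{\sigma,\tau}(Y)$.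 It is continuous from above if for all $\sigma\le\tau$ and every decreasing sequence $X_n$ in $L^\infty(\mathcal F_\tau)$ converging $P$-a.s. to some $X\in L^\infty(\mathcal F_\tau)$, $\rho_{\sigma,\tau}(X_n)$ converges $P$-a.s. to $\rho_{\sigma,\tau}(X)$. It is time consistent if $\rho_{\nu,\sigma}(-\rho_{\sigma,\tau}(X))=\rho_{\nu,\tau}(X)$ for all stopping times $\nu\le\sigma\le\tau$ and all $X\in L^\infty(\mathcal F_\tau)$. For a probability measure $Q\ll P$ the minimal penalty is the $(-\infty,\infty]$-valued random variable, defined $Q$-a.s., $$\alpha_{\sigma,\tau}(Q)=Q\text{-}\operatorname*{ess\,sup}_{X\in L^\infty(\mathcal F_\tau)}\bigl(E_Q(-X\mid\mathcal F_\sigma)-\rho_{\sigma,\tau}(X)\bigr).$$ Expectations and conditional expectations under $Q$ of random variables that are $Q$-a.s. bounded from below are taken in $(-\infty,\infty]$. **Proposition 1.8.** Let $(\rho_{\sigma,\tau})$ be a dynamic risk measure continuous from above. It is time consistent if and only if for all stopping times $\nu\le\sigma\le\tau$ the following two properties hold: 1. for every probability measure $Q\ll P$ such that $E_Q(\alpha_{\nu,\tau}(Q))$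 is finite, and for every $X\in L^\infty(\mathcal F_\tau)$, $$E_Q\bigl(\rho_{\sigma,\tau}(X)+\alpha_{\sigma,\tau}(Q)\mid\mathcal F_\nu\bigr)\le\rho_{\nu,\tau}(X)+\alpha_{\nu,\tau}(Q)\quad Q\text{-a.s.};$$ 2. for every $Z\in L^\infty(\mathcal F_\sigma)$, $\ \rho_{\nu,\sigma}(Z)=\rho_{\nu,\tau}(Z+\rho_{\sigma,\tau}(0))$. -/

import Mathlib

open MeasureTheory Filter Topology
open scoped NNReal ENNReal

namespace DynRisk

/-! ### Stopping times and bounded positions -/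

section StoppingTimes

variable {Ω : Type*} {mΩ : MeasurableSpace Ω}

/-- Stopping times with values in `[0, ∞]`, ordered pointwise. -/
abbrev StoppingTime (𝓕 : Filtration ℝ≥0 mΩ) : Type _ :=
  {τ : Ω → WithTop ℝ≥0 // IsStoppingTime 𝓕 τ}

variable {𝓕 : Filtration ℝ≥0 mΩ}

/-- The σ-algebra `𝓕_τ` of the events `A ∈ 𝓕_∞` with `A ∩ {τ ≤ t} ∈ 𝓕_t` for all `t ≥ 0`. The
ambient σ-algebra `mΩ` plays the role of `𝓕_∞`; when it is generated by the `𝓕_t`, this is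
`IsStoppingTime.measurableSpace`. -/
@[reducible] def sigmaAlg (τ : StoppingTime 𝓕) : MeasurableSpace Ω where
  MeasurableSet' A := MeasurableSet A ∧ ∀ t : ℝ≥0, MeasurableSet[𝓕 t] (A ∩ {ω | τ.1 ω ≤ t})
  measurableSet_empty := by simp
  measurableSet_compl A hA := by
    refine ⟨hA.1.compl, fun t => ?_⟩
    have h : Aᶜ ∩ {ω | τ.1 ω ≤ t} = {ω | τ.1 ω ≤ t} \ (A ∩ {ω | τ.1 ω ≤ t}) := by
      ext ω
      simp only [Set.mem_inter_iff, Set.mem_compl_iff, Set.mem_sdiff]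
      tauto
    rw [h]
    exact (τ.2 t).diff (hA.2 t)
  measurableSet_iUnion A hA := by
    refine ⟨MeasurableSet.iUnion fun n => (hA n).1, fun t => ?_⟩
    rw [Set.iUnion_inter]
    exact MeasurableSet.iUnion fun n => (hA n).2 t

theorem sigmaAlg_le (τ : StoppingTime 𝓕) : sigmaAlg τ ≤ mΩ := fun _ hA => hA.1

theorem sigmaAlg_mono {σ τ : StoppingTime 𝓕} (h : σ ≤ τ) : sigmaAlg σ ≤ sigmaAlg τ := by
  refine fun A hA => ⟨hA.1, fun t => ?_⟩
  have e : A ∩ {ω | τ.1 ω ≤ t} = (A ∩ {ω | σ.1 ω ≤ t}) ∩ {ω | τ.1 ω ≤ t} := by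
    ext ω
    have hω : σ.1 ω ≤ τ.1 ω := h ω
    simp only [Set.mem_inter_iff, Set.mem_ofPred_eq]
    exact ⟨fun ⟨h1, h2⟩ => ⟨⟨h1, hω.trans h2⟩, h2⟩, fun ⟨⟨h1, _⟩, h2⟩ => ⟨h1, h2⟩⟩
  rw [e]
  exact (hA.2 t).inter (τ.2 t)

/-- `L^∞(Ω, 𝓕_τ, P)`: the classes in `L^∞(Ω, 𝓕_∞, P)` that have an `𝓕_τ`-measurable
representative. -/
noncomputable abbrev Linf (P : Measure Ω) (τ : StoppingTime 𝓕) : Submodule ℝ (Lp ℝ ∞ P) :=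
  lpMeas ℝ ℝ (sigmaAlg τ) ∞ P

/-- The inclusion `L^∞(𝓕_σ) ⊆ L^∞(𝓕_τ)` for `σ ≤ τ`. -/
noncomputable def incl (P : Measure Ω) {σ τ : StoppingTime 𝓕} (h : σ ≤ τ) : Linf P σ →ₗ[ℝ] Linf P τ :=
  Submodule.inclusion fun _ hf =>
    mem_lpMeas_iff_aestronglyMeasurable.2
      ((mem_lpMeas_iff_aestronglyMeasurable.1 hf).mono (sigmaAlg_mono h))

end StoppingTimes

/-! ### Essential suprema of families and extended expectations -/

section EssSup

variable {Ω ι : Type*} {mΩ : MeasurableSpace Ω}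

/-- `g` is a `Q`-essential supremum of the family `(f i)`: the `Q`-a.s. least random variable
dominating every `f i` `Q`-a.s. -/
def IsEssSup (Q : Measure Ω) (f : ι → Ω → EReal) (g : Ω → EReal) : Prop :=
  Measurable g ∧ (∀ i, f i ≤ᵐ[Q] g) ∧
    ∀ h : Ω → EReal, Measurable h → (∀ i, f i ≤ᵐ[Q] h) → g ≤ᵐ[Q] h

theorem exists_isEssSup (Q : Measure Ω) [IsFiniteMeasure Q] (f : ι → Ω → EReal)
    (hf : ∀ i, Measurable (f i)) : ∃ g, IsEssSup Q f g := by
  obtain ⟨φ, hφ, hφm, hφ1⟩ : ∃ φ : EReal → ℝ≥0∞, StrictMono φ ∧ Measurable φ ∧ ∀ x, φ x ≤ 1 := by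
    have hs : StrictMono fun x : EReal =>
        ENNReal.ofReal (ENNReal.orderIsoUnitIntervalBirational (EReal.exp x) : ℝ) := by
      intro x y hxy
      have h1 := ENNReal.orderIsoUnitIntervalBirational.strictMono (EReal.exp_strictMono hxy)
      have h2 := (ENNReal.orderIsoUnitIntervalBirational (EReal.exp x)).2.1
      have h3 : ((ENNReal.orderIsoUnitIntervalBirational (EReal.exp x)) : ℝ)
          < ENNReal.orderIsoUnitIntervalBirational (EReal.exp y) := h1
      exact (ENNReal.ofReal_lt_ofReal_iff (h2.trans_lt h3)).2 h3
    refine ⟨_, hs, hs.monotone.measurable, fun x => ?_⟩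
    exact ENNReal.ofReal_le_one.2 (ENNReal.orderIsoUnitIntervalBirational (EReal.exp x)).2.2
  let G : Set ι → Ω → EReal := fun s ω => ⨆ i ∈ s, f i ω
  have hG : ∀ s : Set ι, s.Countable → Measurable (G s) := fun s hs =>
    Measurable.biSup s hs fun i _ => hf i
  have hGmono : ∀ s t : Set ι, s ⊆ t → ∀ ω, G s ω ≤ G t ω := fun s t h ω =>
    biSup_mono fun i hi => h hi
  let I : Set ι → ℝ≥0∞ := fun s => ∫⁻ ω, φ (G s ω) ∂Q
  have hImono : ∀ s t : Set ι, s ⊆ t → I s ≤ I t := fun s t h =>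
    lintegral_mono fun ω => hφ.monotone (hGmono s t h ω)
  have hfin : ∀ s, I s ≠ ∞ := by
    intro s
    have h1 : I s ≤ ∫⁻ _, 1 ∂Q := lintegral_mono fun ω => hφ1 _
    rw [lintegral_one] at h1
    exact ne_top_of_le_ne_top (measure_ne_top Q _) h1
  let V : Set ℝ≥0∞ := I '' {s : Set ι | s.Countable}
  have hV : V.Nonempty := ⟨I ∅, ∅, Set.countable_empty, rfl⟩
  obtain ⟨u, -, hu, huV⟩ := exists_seq_tendsto_sSup hV (OrderTop.bddAbove V)
  choose s hsc hsI using huV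
  let S : Set ι := ⋃ n, s n
  have hSc : S.Countable := Set.countable_iUnion hsc
  have hSI : sSup V ≤ I S := by
    refine le_of_tendsto' hu fun n => ?_
    rw [← hsI n]
    exact hImono _ _ (Set.subset_iUnion s n)
  refine ⟨G S, hG S hSc, fun i => ?_, fun h _ hle => ?_⟩
  · have hic : (insert i S).Countable := hSc.insert i
    have h1 : I (insert i S) ≤ I S :=
      (le_sSup (Set.mem_image_of_mem I hic)).trans hSI
    have h2 : (fun ω => φ (G S ω)) =ᵐ[Q] fun ω => φ (G (insert i S) ω) :=
      ae_eq_of_ae_le_of_lintegral_le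
        (Eventually.of_forall fun ω => hφ.monotone (hGmono _ _ (Set.subset_insert i S) ω))
        (hfin S) (hφm.comp (hG _ hic)).aemeasurable h1
    filter_upwards [h2] with ω hω
    rw [hφ.injective hω]
    exact le_biSup (fun j => f j ω) (Set.mem_insert i S)
  · have h1 : ∀ᵐ ω ∂Q, ∀ i ∈ S, f i ω ≤ h ω := (ae_ball_iff hSc).2 fun i _ => hle i
    filter_upwards [h1] with ω hω
    exact iSup₂_le hω

/-- The `Q`-essential supremum of a family of extended real random variables (a version of it). -/
noncomputable def essSupFamily (Q : Measure Ω) [IsFiniteMeasure Q] (f : ι → Ω → EReal)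
    (hf : ∀ i, Measurable (f i)) : Ω → EReal :=
  (exists_isEssSup Q f hf).choose

theorem isEssSup_essSupFamily (Q : Measure Ω) [IsFiniteMeasure Q] (f : ι → Ω → EReal)
    (hf : ∀ i, Measurable (f i)) : IsEssSup Q f (essSupFamily Q f hf) :=
  (exists_isEssSup Q f hf).choose_spec

/-- Expectation `E_Q(f⁺) - E_Q(f⁻) ∈ [-∞, ∞]` of an extended real random variable whose negative
part is integrable. -/
noncomputable def expect (Q : Measure Ω) (f : Ω → EReal) : EReal :=
  ((∫⁻ ω, (f ω).toENNReal ∂Q : ℝ≥0∞) : EReal) - ((∫⁻ ω, (-f ω).toENNReal ∂Q : ℝ≥0∞) : EReal)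

/-- Conditional expectation `E_Q(f⁺ | m) - E_Q(f⁻ | m)` of an extended real random variable whose
negative part is integrable. -/
noncomputable def condExpect (m : MeasurableSpace Ω) (Q : Measure[mΩ] Ω) (f : Ω → EReal) :
    Ω → EReal := fun ω =>
  (condLExp m Q (fun ω' => (f ω').toENNReal) ω : EReal)
    - (condLExp m Q (fun ω' => (-f ω').toENNReal) ω : EReal)

end EssSup

/-! ### Dynamic risk measures -/

variable {Ω : Type*} {mΩ : MeasurableSpace Ω}

/-- A dynamic risk measure: for all stopping times `σ ≤ τ` a convex conditional risk measure
`ρ_{σ,τ} : L^∞(𝓕_τ) → L^∞(𝓕_σ)`. The order on `L^∞` is the `P`-a.s. order. -/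
structure DynamicRiskMeasure (𝓕 : Filtration ℝ≥0 mΩ) (P : Measure Ω) where
  /-- The map `ρ_{σ,τ}`. -/
  risk : ∀ {σ τ : StoppingTime 𝓕}, σ ≤ τ → Linf P τ → Linf P σ
  monotone : ∀ {σ τ : StoppingTime 𝓕} (h : σ ≤ τ) (X Y : Linf P τ),
    (X : Lp ℝ ∞ P) ≤ Y → (risk h Y : Lp ℝ ∞ P) ≤ risk h X
  translation : ∀ {σ τ : StoppingTime 𝓕} (h : σ ≤ τ) (Z : Linf P σ) (X : Linf P τ),
    risk h (X + incl P h Z) = risk h X - Z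
  convex : ∀ {σ τ : StoppingTime 𝓕} (h : σ ≤ τ) (X Y : Linf P τ) (c : ℝ), 0 ≤ c → c ≤ 1 →
    (risk h (c • X + (1 - c) • Y) : Lp ℝ ∞ P) ≤
      ((c • risk h X + (1 - c) • risk h Y : Linf P σ) : Lp ℝ ∞ P)

namespace DynamicRiskMeasure

variable {𝓕 : Filtration ℝ≥0 mΩ} {P : Measure Ω}

/-- Continuity from above: if `X_n` decreases to `X` (`P`-a.s.) with `X_n, X ∈ L^∞(𝓕_τ)`, then
the increasing sequence `ρ_{σ,τ}(X_n)` converges to `ρ_{σ,τ}(X)` (`P`-a.s.). -/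
def ContinuousFromAbove (ρ : DynamicRiskMeasure 𝓕 P) : Prop :=
  ∀ (σ τ : StoppingTime 𝓕) (h : σ ≤ τ) (X : ℕ → Linf P τ) (X' : Linf P τ),
    (∀ n, (X (n + 1) : Lp ℝ ∞ P) ≤ X n) →
    (∀ᵐ ω ∂P, Tendsto (fun n => (X n : Lp ℝ ∞ P) ω) atTop (𝓝 ((X' : Lp ℝ ∞ P) ω))) →
    ∀ᵐ ω ∂P, Tendsto (fun n => (ρ.risk h (X n) : Lp ℝ ∞ P) ω) atTop
      (𝓝 ((ρ.risk h X' : Lp ℝ ∞ P) ω))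

/-- Time consistency: `ρ_{ν,σ}(-ρ_{σ,τ}(X)) = ρ_{ν,τ}(X)` for all `ν ≤ σ ≤ τ`, `X ∈ L^∞(𝓕_τ)`. -/
def TimeConsistent (ρ : DynamicRiskMeasure 𝓕 P) : Prop :=
  ∀ (ν σ τ : StoppingTime 𝓕) (hνσ : ν ≤ σ) (hστ : σ ≤ τ) (X : Linf P τ),
    ρ.risk hνσ (-ρ.risk hστ X) = ρ.risk (hνσ.trans hστ) X

/-- The random variable `E_Q(-X | 𝓕_σ) - ρ_{σ,τ}(X)`. -/
noncomputable def gap (ρ : DynamicRiskMeasure 𝓕 P) {σ τ : StoppingTime 𝓕} (h : σ ≤ τ)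
    (Q : Measure Ω) (X : Linf P τ) : Ω → EReal := fun ω =>
  ((condExp (sigmaAlg σ) Q (fun ω' => -(X : Lp ℝ ∞ P) ω') ω
    - (ρ.risk h X : Lp ℝ ∞ P) ω : ℝ) : EReal)

theorem measurable_gap (ρ : DynamicRiskMeasure 𝓕 P) {σ τ : StoppingTime 𝓕} (h : σ ≤ τ)
    (Q : Measure Ω) (X : Linf P τ) : Measurable (ρ.gap h Q X) :=
  measurable_coe_real_ereal.comp
    ((stronglyMeasurable_condExp.mono (sigmaAlg_le σ)).measurable.sub
      (Lp.stronglyMeasurable (ρ.risk h X : Lp ℝ ∞ P)).measurable)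

/-- The minimal penalty
`α_{σ,τ}(Q) = Q-ess sup {E_Q(-X | 𝓕_σ) - ρ_{σ,τ}(X) : X ∈ L^∞(Ω, 𝓕_τ, P)}`, for `Q ≪ P`. -/
noncomputable def penalty (ρ : DynamicRiskMeasure 𝓕 P) {σ τ : StoppingTime 𝓕} (h : σ ≤ τ)
    (Q : Measure Ω) [IsFiniteMeasure Q] : Ω → EReal :=
  essSupFamily Q (ρ.gap h Q) (ρ.measurable_gap h Q)

end DynamicRiskMeasure

end DynRisk

/-!
# Time consistency of dynamic risk measures and their minimal penalties

If `ρ` is time consistent, positions with the same risk at time `σ` have the same risk at time `ν`.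
The gaps `E_Q(-Y | 𝓕_σ) - ρ_{σ,τ}(Y)` whose essential supremum is `α_{σ,τ}(Q)` form a directed
family, because risk measures are local (`exists_gap_ge`), and they do not change when `Y` is
shifted by an `𝓕_σ`-measurable position. So `ρ_{σ,τ}(X) + α_{σ,τ}(Q)` is the increasing limit of
variables `E_Q(-Y_n | 𝓕_σ)` with `ρ_{σ,τ}(Y_n) = ρ_{σ,τ}(X)`, hence with
`ρ_{ν,τ}(Y_n) = ρ_{ν,τ}(X)`, and monotone convergence gives the first property
(`TimeConsistent.condExpect_le`). The second one follows from time consistency by translation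
invariance.

Conversely, by the second property and translation invariance, time consistency amounts to
`ρ_{ν,τ}(X) = ρ_{ν,τ}(Y)` whenever `ρ_{σ,τ}(X) = ρ_{σ,τ}(Y)`. By locality it is enough to compare
`E_P(ρ_{ν,τ}(X))` and `E_P(ρ_{ν,τ}(Y))` (`risk_le_of_integral_risk_le`). The functional
`X ↦ E_P(ρ_{ν,τ}(X))` is convex and continuous from above, so it has a dual representation by
probability measures `Q ≪ P` (`ContinuousFromAbove.exists_probability`). The measures of finite
penalty in it agree with `P` on `𝓕_ν` and have finite `E_Q(α_{ν,τ}(Q))`, so that the first property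
applies to them and gives the comparison (`integral_risk_le_of_risk_eq`).

The dual representation is where countable additivity has to be earned: continuity from above only
says that the bounded parts of the acceptance sets are closed in `L²`, and the separating
functionals must be found in `L¹`. This is the Krein-Smulian theorem for `L^∞`, proved here in the
form `exists_integrable_separating` by iterating a minimax argument in the Hilbert space `L²` over
balls of `L^∞` with doubling radii.
-/

namespace DynRisk

/-! ### Separation in Hilbert spaces -/

section Hilbert

variable {H : Type*} [NormedAddCommGroup H] [InnerProductSpace ℝ H]

/-- Bounded closed convex sets of a Hilbert space are weakly compact: by the Riesz representation
the weak topology is the weak-* topology of the dual, where Banach-Alaoglu applies. -/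
theorem isCompact_toWeakSpace_image [CompleteSpace H] {K : Set H} (hK : Convex ℝ K)
    (hKc : IsClosed K) (hKb : Bornology.IsBounded K) : IsCompact (toWeakSpace ℝ H '' K) := by
  obtain ⟨r, hr⟩ := (Metric.isBounded_iff_subset_closedBall (0 : H)).1 hKb
  have hball : IsCompact (toWeakSpace ℝ H '' Metric.closedBall 0 r) := by
    let J : WeakDual ℝ H → WeakSpace ℝ H := fun f =>
      toWeakSpace ℝ H ((InnerProductSpace.toDual ℝ H).symm (WeakDual.toStrongDual f))
    have hJ : Continuous J := by
      refine WeakBilin.continuous_of_continuous_eval _ fun ℓ => ?_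
      have e : ∀ f : WeakDual ℝ H, (topDualPairing ℝ H).flip (J f) ℓ
          = f ((InnerProductSpace.toDual ℝ H).symm ℓ) := by
        intro f
        change ℓ ((InnerProductSpace.toDual ℝ H).symm (WeakDual.toStrongDual f)) = _
        rw [← InnerProductSpace.toDual_symm_apply, real_inner_comm,
          InnerProductSpace.toDual_symm_apply]
        rfl
      simp only [e]
      exact WeakDual.eval_continuous _
    have := (WeakDual.isCompact_closedBall (0 : StrongDual ℝ H) r).image hJ
    refine (congrArg IsCompact ?_).mp this
    ext y
    constructor
    · rintro ⟨f, hf, rfl⟩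
      refine ⟨_, ?_, rfl⟩
      simpa using hf
    · rintro ⟨x, hx, rfl⟩
      refine ⟨StrongDual.toWeakDual (InnerProductSpace.toDual ℝ H x), ?_, ?_⟩
      · simpa using hx
      · simp [J]
  refine hball.of_isClosed_subset ?_ (Set.image_mono hr)
  rw [← hKc.closure_eq, hK.toWeakSpace_closure ℝ]
  exact isClosed_closure

/-- Let `‖x‖_D = inf {s | (x, s) ∈ D}` be the gauge whose epigraph is the closed convex cone `D`. If
`⟪g, x⟫ + ε ‖x‖_D ≥ b` on a bounded closed convex set `K`, then moving `g` by a functional of dual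
gauge at most `ε` yields `h` with `⟪h, x⟫ ≥ b'` on `K`, for any `b' < b`. This is the minimax
equality for `⟪h, x⟫`, obtained by separating the graph of `x ↦ (b' - ⟪g, x⟫) / ε` over `K`, which
is weakly compact, from the cone `D`. -/
theorem exists_functional_perturbation [CompleteSpace H] {D : Set (H × ℝ)} (hDc : IsClosed D)
    (hD : Convex ℝ D) (hcone : ∀ c : ℝ, 0 < c → ∀ p ∈ D, c • p ∈ D) (h0 : (0, 0) ∈ D)
    (h1 : ((0 : H), (1 : ℝ)) ∈ D) (hsymm : ∀ p ∈ D, (-p.1, p.2) ∈ D)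
    {K : Set H} (hK : Convex ℝ K)
    (hKc : IsClosed K) (hKb : Bornology.IsBounded K) {s₀ : ℝ}
    (hKs : ∀ x ∈ K, (x, s₀) ∈ D)
    (g : H) {ε b b' : ℝ} (hε : 0 < ε) (hb : b' < b)
    (hg : ∀ x ∈ K, ∀ s, (x, s) ∈ D → b ≤ inner ℝ g x + ε * s) :
    ∃ h : H, (∀ w, (w, (1 : ℝ)) ∈ D → inner ℝ (h - g) w ≤ ε) ∧ ∀ x ∈ K, b' ≤ inner ℝ h x := by
  obtain rfl | ⟨x₀, hx₀⟩ := K.eq_empty_or_nonempty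
  · exact ⟨g, by simp [hε.le], by simp⟩
  -- `L x` lies in the translated cone `D'` iff the point `(b' - ⟪g, x⟫) / ε` of the graph over `x`
  -- lies in `D`, which `b' < b` excludes for `x ∈ K`
  let D' : Set (H × ℝ) := {p | p + (0, b' / ε) ∈ D}
  let L : H →L[ℝ] H × ℝ := (ContinuousLinearMap.id ℝ H).prod (-(1 / ε) • innerSL ℝ g)
  have hL : ∀ x, L x = (x, -(1 / ε) * inner ℝ g x) := fun x => by simp [L]
  have hD'c : IsClosed D' :=
    hDc.preimage (by fun_prop : Continuous fun p : H × ℝ => p + (0, b' / ε))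
  have hD' : Convex ℝ D' := hD.translate_preimage_left _
  have hcomp : IsCompact (toWeakSpace ℝ (H × ℝ) '' (L '' K)) := by
    have := (isCompact_toWeakSpace_image hK hKc hKb).image (WeakSpace.map L).continuous
    rw [Set.image_image] at this ⊢
    exact this
  have hclosed : IsClosed (toWeakSpace ℝ (H × ℝ) '' D') := by
    rw [← hD'c.closure_eq, hD'.toWeakSpace_closure ℝ]
    exact isClosed_closure
  have hdisj : Disjoint (toWeakSpace ℝ (H × ℝ) '' (L '' K)) (toWeakSpace ℝ (H × ℝ) '' D') := by
    rw [Set.disjoint_image_iff (toWeakSpace ℝ (H × ℝ)).injective, Set.disjoint_left]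
    rintro _ ⟨x, hx, rfl⟩ hxD
    have h2 : (x, -(1 / ε) * inner ℝ g x + b' / ε) ∈ D := by
      have : L x + (0, b' / ε) ∈ D := hxD
      simpa [hL] using this
    have h3 := hg x hx _ h2
    have h4 : ε * (-(1 / ε) * inner ℝ g x + b' / ε) = b' - inner ℝ g x := by
      field_simp
      ring
    linarith
  have : LocallyConvexSpace ℝ (WeakSpace ℝ (H × ℝ)) := WeakBilin.locallyConvexSpace
  obtain ⟨f', u, v, hu, huv, hv⟩ := geometric_hahn_banach_compact_closed
    ((hK.linear_image L.toLinearMap).linear_image (toWeakSpace ℝ (H × ℝ)).toLinearMap)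
    hcomp (hD'.linear_image (toWeakSpace ℝ (H × ℝ)).toLinearMap) hclosed hdisj
  let f : H × ℝ →L[ℝ] ℝ := f'.comp (toWeakSpaceCLM ℝ (H × ℝ))
  have hfK : ∀ x ∈ K, f (L x) < u := fun x hx => hu _ ⟨_, ⟨x, hx, rfl⟩, rfl⟩
  have hfD : ∀ p ∈ D, v < f p - f (0, b' / ε) := by
    intro p hp
    rw [← map_sub]
    refine hv _ ⟨p - (0, b' / ε), ?_, rfl⟩
    change p - (0, b' / ε) + (0, b' / ε) ∈ D
    rwa [sub_add_cancel]
  -- a functional bounded below on a cone is nonnegative there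
  have hfpos : ∀ p ∈ D, 0 ≤ f p := by
    intro p hp
    by_contra! hneg
    have h2 : v + f (0, b' / ε) < 0 := by
      have := hfD _ h0
      simp only [Prod.mk_zero_zero, map_zero] at this
      linarith
    have h3 := hfD _ (hcone ((v + f (0, b' / ε)) / f p) (div_pos_of_neg_of_neg h2 hneg) p hp)
    rw [map_smul, smul_eq_mul, div_mul_cancel₀ _ hneg.ne] at h3
    linarith
  have hvneg : v + f (0, b' / ε) < 0 := by
    have := hfD _ h0
    simp only [Prod.mk_zero_zero, map_zero] at this
    linarith
  let q : H := (InnerProductSpace.toDual ℝ H).symm (f.comp (ContinuousLinearMap.inl ℝ H ℝ))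
  let l : ℝ := f (0, 1)
  have hf : ∀ (x : H) (s : ℝ), f (x, s) = inner ℝ q x + l * s := by
    intro x s
    have e : ((x, s) : H × ℝ) = (x, 0) + s • (0, 1) := by simp
    rw [e, map_add, map_smul, InnerProductSpace.toDual_symm_apply]
    simp [l, mul_comm]
  have hl : 0 ≤ l := hfpos _ h1
  have hqD : ∀ x s, (x, s) ∈ D → |inner ℝ q x| ≤ l * s := by
    intro x s hx
    have h2 := hfpos _ hx
    have h3 := hfpos _ (hsymm _ hx)
    rw [hf] at h2 h3
    rw [inner_neg_right] at h3
    exact abs_le.2 ⟨by linarith, by linarith⟩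
  have hKu : ∀ x ∈ K, inner ℝ q x + l * (b' - inner ℝ g x) / ε < 0 := by
    intro x hx
    have h2 := hfK x hx
    rw [hL, hf] at h2
    rw [hf, inner_zero_right] at hvneg
    have e : l * (b' - inner ℝ g x) / ε = l * (-(1 / ε) * inner ℝ g x) + l * (b' / ε) := by
      field_simp
      ring
    rw [e]
    linarith
  -- for `l = 0` the functional would vanish on the elements of finite gauge, hence on `K`
  have hl0 : 0 < l := by
    refine lt_of_le_of_ne hl fun h => ?_
    have h2 := hKu x₀ hx₀
    have h3 := hqD _ _ (hKs x₀ hx₀)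
    rw [← h, zero_mul] at h3
    rw [← h, abs_nonpos_iff.1 h3] at h2
    simp at h2
  refine ⟨g - (ε / l) • q, fun w hw => ?_, fun x hx => ?_⟩
  · have h2 := abs_le.1 (hqD _ _ hw)
    rw [sub_sub_cancel_left, inner_neg_left, real_inner_smul_left]
    have h3 : ε / l * (-inner ℝ q w) ≤ ε / l * l :=
      mul_le_mul_of_nonneg_left (by linarith) (by positivity)
    rw [div_mul_cancel₀ _ hl0.ne'] at h3
    linarith
  · have h2 := hKu x hx
    rw [inner_sub_left, real_inner_smul_left]
    have h3 : (ε / l) * (inner ℝ q x + l * (b' - inner ℝ g x) / ε)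
        = ε / l * inner ℝ q x + (b' - inner ℝ g x) := by
      field_simp
    have h4 := mul_neg_of_pos_of_neg (div_pos hε hl0) h2
    linarith

end Hilbert

/-! ### Separation by integrable functions: a Krein-Smulian argument -/

section KreinSmulian

variable {Ω : Type*} {mΩ : MeasurableSpace Ω} {P : Measure Ω}

/-- The elements of `L²` that are bounded by `R` almost everywhere, that is, the closed ball of
radius `R` of `L^∞` regarded as a subset of `L²`. -/
def essBall (P : Measure Ω) (R : ℝ) : Set (Lp ℝ 2 P) := {X | ∀ᵐ ω ∂P, |X ω| ≤ R}

/-- The epigraph in `L² × ℝ` of the (extended-valued) norm of `L^∞`. -/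
def essCone (P : Measure Ω) : Set (Lp ℝ 2 P × ℝ) := {p | p.1 ∈ essBall P p.2}

theorem mem_essBall {X : Lp ℝ 2 P} {R : ℝ} : X ∈ essBall P R ↔ ∀ᵐ ω ∂P, |X ω| ≤ R := Iff.rfl

theorem mem_essCone {X : Lp ℝ 2 P} {R : ℝ} : (X, R) ∈ essCone P ↔ ∀ᵐ ω ∂P, |X ω| ≤ R := Iff.rfl

theorem inner_L2_eq (g X : Lp ℝ 2 P) : inner ℝ g X = ∫ ω, g ω * X ω ∂P := by
  rw [L2.inner_def]
  exact integral_congr_ae (Eventually.of_forall fun ω => by simp [mul_comm])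

theorem essBall_mono {R R' : ℝ} (h : R ≤ R') : essBall P R ⊆ essBall P R' := fun X hX => by
  filter_upwards [mem_essBall.1 hX] with ω hω using hω.trans h

theorem smul_add_smul_mem_essBall {X Y : Lp ℝ 2 P} {R S a b : ℝ} (hX : X ∈ essBall P R)
    (hY : Y ∈ essBall P S) (ha : 0 ≤ a) (hb : 0 ≤ b) :
    a • X + b • Y ∈ essBall P (a * R + b * S) := by
  filter_upwards [mem_essBall.1 hX, mem_essBall.1 hY, Lp.coeFn_add (a • X) (b • Y),
    Lp.coeFn_smul a X, Lp.coeFn_smul b Y] with ω h1 h2 h3 h4 h5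
  simp only [h3, Pi.add_apply, h4, h5, Pi.smul_apply, smul_eq_mul]
  refine (abs_add_le _ _).trans ?_
  rw [abs_mul, abs_mul, abs_of_nonneg ha, abs_of_nonneg hb]
  gcongr

theorem convex_essCone : Convex ℝ (essCone P) := by
  rintro ⟨X, R⟩ hX ⟨Y, S⟩ hY a b ha hb -
  exact smul_add_smul_mem_essBall hX hY ha hb

theorem convex_essBall (R : ℝ) : Convex ℝ (essBall P R) := by
  intro X hX Y hY a b ha hb hab
  have := smul_add_smul_mem_essBall hX hY ha hb
  rwa [← add_mul, hab, one_mul] at this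

variable [IsProbabilityMeasure P]

theorem nonneg_of_mem_essBall {X : Lp ℝ 2 P} {R : ℝ} (h : X ∈ essBall P R) : 0 ≤ R := by
  obtain ⟨ω, hω⟩ := (mem_essBall.1 h).exists
  exact (abs_nonneg _).trans hω

theorem isClosed_essCone : IsClosed (essCone P) := by
  have e : essCone P = {p | p.1 ≤ p.2 • Lp.const 2 P (1 : ℝ)} ∩
      {p | -p.1 ≤ p.2 • Lp.const 2 P (1 : ℝ)} := by
    ext ⟨X, R⟩
    rw [mem_essCone, Set.mem_inter_iff, Set.mem_ofPred_eq, Set.mem_ofPred_eq, ← Lp.coeFn_le,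
      ← Lp.coeFn_le]
    have h1 := Lp.coeFn_smul R (Lp.const 2 P (1 : ℝ))
    have h2 := Lp.coeFn_const (p := 2) (μ := P) (1 : ℝ)
    have h3 := Lp.coeFn_neg X
    constructor
    · intro h
      constructor
      · filter_upwards [h, h1, h2] with ω a1 a2 a3
        simp only [a2, Pi.smul_apply, a3, Function.const_apply, smul_eq_mul, mul_one]
        exact (abs_le.1 a1).2
      · filter_upwards [h, h1, h2, h3] with ω a1 a2 a3 a4
        simp only [a4, a2, Pi.smul_apply, a3, Function.const_apply, smul_eq_mul, mul_one,
          Pi.neg_apply]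
        linarith [(abs_le.1 a1).1]
    · rintro ⟨h, h'⟩
      filter_upwards [h, h', h1, h2, h3] with ω a1 a1' a2 a3 a4
      simp only [a2, Pi.smul_apply, a3, Function.const_apply, smul_eq_mul, mul_one] at a1
      simp only [a4, a2, Pi.smul_apply, a3, Function.const_apply, smul_eq_mul, mul_one,
          Pi.neg_apply] at a1'
      exact abs_le.2 ⟨by linarith, a1⟩
  rw [e]
  exact (isClosed_le (by fun_prop) (by fun_prop)).inter (isClosed_le (by fun_prop) (by fun_prop))

theorem integrable_coe_L2 (g : Lp ℝ 2 P) : Integrable g P := (Lp.memLp g).integrable (by norm_num)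

theorem isBounded_essBall (R : ℝ) : Bornology.IsBounded (essBall P R) := by
  refine (Metric.isBounded_iff_subset_closedBall 0).2 ⟨|R|, fun X hX => ?_⟩
  rw [mem_closedBall_zero_iff]
  have := Lp.norm_le_of_ae_bound (abs_nonneg R) (f := X) (by
    filter_upwards [mem_essBall.1 hX] with ω h using h.trans (le_abs_self R))
  simpa [measureUnivNNReal] using this

/-- On `L²` the norm dual to that of `L^∞` is the `L¹` norm; the supremum is attained at the sign of
`h`. -/
theorem integral_abs_le_of_inner_le {h : Lp ℝ 2 P} {ε : ℝ}
    (hh : ∀ w ∈ essBall P 1, inner ℝ h w ≤ ε) : ∫ ω, |h ω| ∂P ≤ ε := by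
  have hm : AEStronglyMeasurable (fun ω => (SignType.sign (h ω) : ℝ)) P := by
    have h1 : Measurable fun ω => (SignType.sign (h ω) : ℝ) := by
      have h2 : Measurable fun x : ℝ => (SignType.sign x : ℝ) := by
        have : (fun x : ℝ => (SignType.sign x : ℝ))
            = fun x => if 0 < x then 1 else if x < 0 then -1 else 0 := by
          ext x
          rcases lt_trichotomy x 0 with h | h | h
          · simp [h, not_lt.2 h.le]
          · simp [h]
          · simp [h]
        rw [this]
        exact Measurable.ite measurableSet_Ioi measurable_const
          (Measurable.ite measurableSet_Iio measurable_const measurable_const)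
      exact h2.comp (Lp.stronglyMeasurable h).measurable
    exact h1.aestronglyMeasurable
  have hb : ∀ x : ℝ, |(SignType.sign x : ℝ)| ≤ 1 := by
    intro x
    rcases lt_trichotomy x 0 with h | h | h <;> simp [h]
  have hmem : MemLp (fun ω => (SignType.sign (h ω) : ℝ)) 2 P :=
    MemLp.of_bound hm 1 (Eventually.of_forall fun ω => hb _)
  have h1 := hh (hmem.toLp _) (by
    filter_upwards [hmem.coeFn_toLp] with ω hω
    rw [hω]
    exact hb _)
  rw [inner_L2_eq] at h1
  refine le_trans (le_of_eq (integral_congr_ae ?_)) h1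
  filter_upwards [hmem.coeFn_toLp] with ω hω
  rw [hω, self_mul_sign]

/-- Induction step of the Krein-Smulian argument: a functional `g` with `⟪g, X⟫ ≥ b` on `C ∩ L^∞(R)`
can be moved by `2M / R` in `L¹` so as to be at least `b'` on `C ∩ L^∞(2R)`, where `M` bounds its
value at a point `X₀` of `C` that is small compared with `R`. -/
theorem exists_perturbation_double {C : Set (Lp ℝ 2 P)} (hC : Convex ℝ C)
    (hclosed : ∀ R, IsClosed (C ∩ essBall P R)) {X₀ : Lp ℝ 2 P} {r R M b b' : ℝ}
    (hX₀ : X₀ ∈ C ∩ essBall P r) (hR : 0 < R) (hrR : 2 * r ≤ R) (hM : 0 < M) (hb0 : 0 ≤ b)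
    (hb : b' < b) {g : Lp ℝ 2 P} (hgC : ∀ X ∈ C ∩ essBall P R, b ≤ inner ℝ g X)
    (hgX : inner ℝ g X₀ ≤ M) :
    ∃ h : Lp ℝ 2 P, ∫ ω, |(h - g : Lp ℝ 2 P) ω| ∂P ≤ 2 * M / R ∧
      ∀ X ∈ C ∩ essBall P (2 * R), b' ≤ inner ℝ h X := by
  have hsm : ∀ c : ℝ, 0 < c → ∀ p ∈ essCone P, c • p ∈ essCone P := by
    rintro c hc ⟨X, s⟩ hp
    have := smul_add_smul_mem_essBall (a := c) (b := 0) hp hp hc.le le_rfl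
    rwa [zero_smul, zero_mul, add_zero, add_zero] at this
  obtain ⟨h, h1, h2⟩ := exists_functional_perturbation (D := essCone P) isClosed_essCone
    convex_essCone hsm (by
      filter_upwards [Lp.coeFn_zero ℝ 2 P] with ω hω
      simp) (by
      filter_upwards [Lp.coeFn_zero ℝ 2 P] with ω hω
      simp) (by
      rintro ⟨X, s⟩ hp
      filter_upwards [mem_essCone.1 hp, Lp.coeFn_neg X] with ω h1 h2
      rwa [h2, Pi.neg_apply, abs_neg])
    (K := C ∩ essBall P (2 * R)) (hC.inter (convex_essBall _)) (hclosed _)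
    ((isBounded_essBall _).subset Set.inter_subset_right) (s₀ := 2 * R) (fun X hX => hX.2) g
    (ε := 2 * M / R) (by positivity) hb (by
      intro X hX s hs
      have hs0 : 0 ≤ s := nonneg_of_mem_essBall hs
      rcases le_or_gt s R with hsR | hsR
      · have h1 := hgC X ⟨hX.1, essBall_mono hsR hs⟩
        have h2 : 0 ≤ 2 * M / R * s := by positivity
        linarith
      -- `X / 3 + 2 X₀ / 3` is a point of `C` bounded by `R`, so that `⟪g, X⟫ ≥ 3 b - 2 M`, and the
      -- term `ε s ≥ 2 M` makes up for the loss
      · have h1 := hgC ((1 / 3 : ℝ) • X + (2 / 3 : ℝ) • X₀)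
          ⟨hC hX.1 hX₀.1 (by norm_num) (by norm_num) (by norm_num),
            essBall_mono (by linarith)
              (smul_add_smul_mem_essBall hX.2 hX₀.2 (by norm_num) (by norm_num))⟩
        rw [inner_add_right, real_inner_smul_right, real_inner_smul_right] at h1
        have h2 : 2 * M / R * R ≤ 2 * M / R * s :=
          mul_le_mul_of_nonneg_left hsR.le (by positivity)
        rw [div_mul_cancel₀ _ hR.ne'] at h2
        linarith)
  exact ⟨h, integral_abs_le_of_inner_le h1, h2⟩

theorem inner_sub_le_of_integral_abs_le {g h X : Lp ℝ 2 P} {ε r : ℝ}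
    (hgh : ∫ ω, |(h - g : Lp ℝ 2 P) ω| ∂P ≤ ε) (hX : X ∈ essBall P r) :
    |(inner ℝ h X : ℝ) - inner ℝ g X| ≤ ε * r := by
  rw [← inner_sub_left, inner_L2_eq]
  have hr : 0 ≤ r := nonneg_of_mem_essBall (P := P) hX
  calc |∫ ω, (h - g : Lp ℝ 2 P) ω * X ω ∂P| ≤ ∫ ω, |(h - g : Lp ℝ 2 P) ω| * r ∂P := by
        rw [← Real.norm_eq_abs]
        refine norm_integral_le_of_norm_le ((integrable_coe_L2 (h - g)).abs.mul_const r) ?_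
        filter_upwards [mem_essBall.1 hX] with ω hω
        rw [Real.norm_eq_abs, abs_mul]
        gcongr
    _ ≤ ε * r := by
        rw [integral_mul_const]
        gcongr

/-- A convex set `C ⊆ L^∞` whose bounded parts are closed in `L²` and that does not contain `0` is
strictly separated from `0` by a function in `L¹`. This is the consequence of the Krein-Smulian
theorem for `L^∞ = (L¹)*` that the dual representation needs. Functionals `g_k ∈ L²` that separate
`C ∩ L^∞(8 r 2 ^ k)` from `0` are built inductively, with increments geometrically small in `L¹`. -/
theorem exists_integrable_separating {C : Set (Lp ℝ 2 P)} (hC : Convex ℝ C)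
    (hbdd : ∀ X ∈ C, ∃ R, X ∈ essBall P R)
    (hclosed : ∀ R, IsClosed (C ∩ essBall P R)) (h0 : 0 ∉ C) :
    ∃ g : Ω → ℝ, Integrable g P ∧ ∀ X ∈ C, 1 ≤ ∫ ω, g ω * X ω ∂P := by
  obtain rfl | ⟨X₀, hX₀⟩ := C.eq_empty_or_nonempty
  · exact ⟨0, integrable_zero _ _ _, by simp⟩
  obtain ⟨r, hr, hX₀r⟩ : ∃ r, 0 < r ∧ X₀ ∈ essBall P r := by
    obtain ⟨R, hR⟩ := hbdd X₀ hX₀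
    exact ⟨R + 1, by linarith [nonneg_of_mem_essBall hR], essBall_mono (by linarith) hR⟩
  obtain ⟨g₀, hg₀⟩ : ∃ g₀ : Lp ℝ 2 P, ∀ X ∈ C ∩ essBall P (8 * r), 2 ≤ inner ℝ g₀ X := by
    obtain ⟨f, u, hu, hf⟩ := geometric_hahn_banach_point_closed (x := (0 : Lp ℝ 2 P))
      (hC.inter (convex_essBall (8 * r))) (hclosed _) (fun h => h0 h.1)
    rw [map_zero] at hu
    refine ⟨(2 / u) • (InnerProductSpace.toDual ℝ _).symm f, fun X hX => ?_⟩
    rw [real_inner_smul_left, InnerProductSpace.toDual_symm_apply]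
    calc (2 : ℝ) = 2 / u * u := by field_simp
      _ ≤ _ := mul_le_mul_of_nonneg_left (hf X hX).le (by positivity)
  set M : ℝ := 2 * inner ℝ g₀ X₀ with hM_def
  have hM : 4 ≤ M := by
    have := hg₀ X₀ ⟨hX₀, essBall_mono (by linarith) hX₀r⟩
    linarith
  -- The bound on `⟪g_k, X₀⟫` stays below `M`: the `k`-th increment has `L¹` norm at most
  -- `2 M / (8 r 2 ^ k)` and `X₀` is bounded by `r`, so it adds at most `M / 4 * (1 / 2) ^ k`.
  let p : ℕ → Lp ℝ 2 P → Prop := fun k g =>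
    (∀ X ∈ C ∩ essBall P (8 * r * 2 ^ k), 1 + (1 / 2) ^ k ≤ inner ℝ g X) ∧
      inner ℝ g X₀ ≤ M - M / 2 * (1 / 2) ^ k
  let rel : ℕ → Lp ℝ 2 P → Lp ℝ 2 P → Prop := fun k g h =>
    ∫ ω, |(h - g : Lp ℝ 2 P) ω| ∂P ≤ M / (4 * r) * (1 / 2) ^ k
  have hstep : ∀ k g, p k g → ∃ h, p (k + 1) h ∧ rel k g h := by
    rintro k g ⟨h1, h2⟩
    have hk : (0 : ℝ) < (1 / 2) ^ k := by positivity
    have hk2 : (1 : ℝ) ≤ 2 ^ k := one_le_pow₀ (by norm_num)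
    obtain ⟨h, h3, h4⟩ := exists_perturbation_double hC hclosed ⟨hX₀, hX₀r⟩
      (R := 8 * r * 2 ^ k) (M := M) (b := 1 + (1 / 2) ^ k) (b' := 1 + (1 / 2) ^ (k + 1))
      (by positivity) (by nlinarith) (by linarith) (by positivity)
      (by rw [pow_succ]; linarith) h1 (h2.trans (by nlinarith))
    have e : 2 * M / (8 * r * 2 ^ k) = M / (4 * r) * (1 / 2) ^ k := by
      rw [one_div, inv_pow]
      field_simp
      norm_num
    rw [e] at h3
    refine ⟨h, ⟨?_, ?_⟩, h3⟩
    · have e2 : 8 * r * 2 ^ (k + 1) = 2 * (8 * r * 2 ^ k) := by ring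
      rw [e2]
      exact h4
    · have h5 := (abs_le.1 (inner_sub_le_of_integral_abs_le h3 hX₀r)).2
      have e3 : M / (4 * r) * (1 / 2) ^ k * r = M / 4 * (1 / 2) ^ k := by
        field_simp
      rw [pow_succ]
      linarith
  choose! F hF using hstep
  let G : ℕ → Lp ℝ 2 P := fun k => Nat.rec g₀ (fun k g => F k g) k
  have hG0 : p 0 g₀ := by
    refine ⟨fun X hX => ?_, by simp only [pow_zero]; linarith⟩
    rw [pow_zero, mul_one] at hX
    have := hg₀ X hX
    norm_num
    linarith
  have hG : ∀ k, p k (G k) := fun k => by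
    induction k with
    | zero => exact hG0
    | succ k ih => exact (hF k _ ih).1
  have hGrel : ∀ k, rel k (G k) (G (k + 1)) := fun k => (hF k _ (hG k)).2
  -- the densities converge in `L¹`
  let T : ℕ → Lp ℝ 1 P := fun k => (integrable_coe_L2 (G k)).toL1
  have hT : ∀ k, dist (T k) (T (k + 1)) ≤ M / (4 * r) * (1 / 2) ^ k := by
    intro k
    refine le_trans (le_of_eq ?_) (hGrel k)
    rw [dist_comm, dist_eq_norm, L1.norm_eq_integral_norm]
    refine integral_congr_ae ?_
    filter_upwards [Lp.coeFn_sub (T (k + 1)) (T k), (integrable_coe_L2 (G k)).coeFn_toL1,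
      (integrable_coe_L2 (G (k + 1))).coeFn_toL1, Lp.coeFn_sub (G (k + 1)) (G k)]
      with ω a1 a2 a3 a4
    rw [a1, a4, Pi.sub_apply, Pi.sub_apply, a2, a3, Real.norm_eq_abs]
  obtain ⟨g, hg⟩ := cauchySeq_tendsto_of_complete (cauchySeq_of_le_geometric _ _ (by norm_num) hT)
  refine ⟨g, L1.integrable_coeFn g, fun X hX => ?_⟩
  obtain ⟨R, hR⟩ := hbdd X hX
  have hXm : AEStronglyMeasurable X P := Lp.aestronglyMeasurable X
  have hlim : Tendsto (fun k => inner ℝ (G k) X) atTop (𝓝 (∫ ω, g ω * X ω ∂P)) := by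
    rw [tendsto_iff_dist_tendsto_zero]
    have hz : Tendsto (fun k => dist (T k) g * R) atTop (𝓝 0) := by
      have := (tendsto_iff_dist_tendsto_zero.1 hg).mul_const R
      rwa [zero_mul] at this
    refine squeeze_zero (fun _ => dist_nonneg) (fun k => ?_) hz
    have hi1 : Integrable (fun ω => G k ω * X ω) P :=
      (integrable_coe_L2 (G k)).mul_bdd hXm (mem_essBall.1 hR)
    have hi2 : Integrable (fun ω => g ω * X ω) P :=
      (L1.integrable_coeFn g).mul_bdd hXm (mem_essBall.1 hR)
    rw [inner_L2_eq, dist_eq_norm, ← integral_sub hi1 hi2, dist_eq_norm, L1.norm_eq_integral_norm,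
      ← integral_mul_const]
    refine norm_integral_le_of_norm_le ((L1.integrable_coeFn _).norm.mul_const R) ?_
    filter_upwards [mem_essBall.1 hR, Lp.coeFn_sub (T k) g, (integrable_coe_L2 (G k)).coeFn_toL1]
      with ω a1 a2 a3
    rw [a2, Pi.sub_apply, a3, ← sub_mul, norm_mul]
    gcongr
    exact a1
  refine ge_of_tendsto hlim ?_
  have hev : ∀ᶠ k : ℕ in atTop, R ≤ 8 * r * 2 ^ k := by
    have : Tendsto (fun k : ℕ => 8 * r * (2 : ℝ) ^ k) atTop atTop :=
      (tendsto_pow_atTop_atTop_of_one_lt (by norm_num)).const_mul_atTop (by positivity)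
    exact this.eventually_ge_atTop R
  filter_upwards [hev] with k hk
  have h1 := (hG k).1 X ⟨hX, essBall_mono hk hR⟩
  have h2 : (0 : ℝ) < (1 / 2) ^ k := by positivity
  linarith

end KreinSmulian

/-! ### Bounded positions, locality and directedness -/

section Positions

variable {Ω : Type*} {mΩ : MeasurableSpace Ω} {𝓕 : Filtration ℝ≥0 mΩ} {P : Measure Ω}
  {σ τ : StoppingTime 𝓕}

theorem Linf.aestronglyMeasurable (X : Linf P τ) :
    AEStronglyMeasurable[sigmaAlg τ] (X : Lp ℝ ∞ P) P :=
  mem_lpMeas_iff_aestronglyMeasurable.1 X.2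

theorem Linf.exists_bound (X : Linf P τ) : ∃ c : ℝ, 0 ≤ c ∧ ∀ᵐ ω ∂P, |(X : Lp ℝ ∞ P) ω| ≤ c := by
  refine ⟨‖(X : Lp ℝ ∞ P)‖, norm_nonneg _, ?_⟩
  have h1 : ∀ᵐ ω ∂P, ‖(X : Lp ℝ ∞ P) ω‖ₑ ≤ eLpNorm (X : Lp ℝ ∞ P) ∞ P := by
    rw [eLpNorm_exponent_top]
    exact ae_le_eLpNormEssSup
  filter_upwards [h1] with ω hω
  rw [Lp.norm_def, ← Real.norm_eq_abs, ← toReal_enorm]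
  exact ENNReal.toReal_mono (Lp.eLpNorm_ne_top _) hω

theorem Linf.exists_ae_eq {f : Ω → ℝ} (hf : AEStronglyMeasurable[sigmaAlg τ] f P) {c : ℝ}
    (hc : ∀ᵐ ω ∂P, |f ω| ≤ c) : ∃ X : Linf P τ, (X : Lp ℝ ∞ P) =ᵐ[P] f := by
  have hm : MemLp f ∞ P := memLp_top_of_bound (hf.mono (sigmaAlg_le τ)) c hc
  exact ⟨⟨hm.toLp f, mem_lpMeas_iff_aestronglyMeasurable.2 (hf.congr hm.coeFn_toLp.symm)⟩,
    hm.coeFn_toLp⟩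

theorem Linf.ext_ae {X Y : Linf P τ} (h : (X : Lp ℝ ∞ P) =ᵐ[P] (Y : Lp ℝ ∞ P)) : X = Y :=
  Subtype.ext (Lp.ext h)

theorem Linf.coeFn_add (X Y : Linf P τ) :
    ((X + Y : Linf P τ) : Lp ℝ ∞ P) =ᵐ[P] fun ω => (X : Lp ℝ ∞ P) ω + (Y : Lp ℝ ∞ P) ω :=
  Lp.coeFn_add _ _

theorem Linf.coeFn_sub (X Y : Linf P τ) :
    ((X - Y : Linf P τ) : Lp ℝ ∞ P) =ᵐ[P] fun ω => (X : Lp ℝ ∞ P) ω - (Y : Lp ℝ ∞ P) ω :=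
  Lp.coeFn_sub _ _

theorem Linf.coeFn_smul (c : ℝ) (X : Linf P τ) :
    ((c • X : Linf P τ) : Lp ℝ ∞ P) =ᵐ[P] fun ω => c * (X : Lp ℝ ∞ P) ω :=
  Lp.coeFn_smul _ _

theorem coe_incl (h : σ ≤ τ) (Z : Linf P σ) : (incl P h Z : Lp ℝ ∞ P) = Z := rfl

/-- The position `1_A X + 1_{Aᶜ} Y`. -/
theorem Linf.exists_piecewise {A : Set Ω} (hA : MeasurableSet[sigmaAlg τ] A) (X Y : Linf P τ) :
    ∃ W : Linf P τ, (∀ᵐ ω ∂P, ω ∈ A → (W : Lp ℝ ∞ P) ω = (X : Lp ℝ ∞ P) ω) ∧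
      ∀ᵐ ω ∂P, ω ∉ A → (W : Lp ℝ ∞ P) ω = (Y : Lp ℝ ∞ P) ω := by
  classical
  obtain ⟨c, hc0, hc⟩ := Linf.exists_bound X
  obtain ⟨d, hd0, hd⟩ := Linf.exists_bound Y
  obtain ⟨x, hx, hXx⟩ := Linf.aestronglyMeasurable X
  obtain ⟨y, hy, hYy⟩ := Linf.aestronglyMeasurable Y
  obtain ⟨W, hW⟩ := Linf.exists_ae_eq (τ := τ) (P := P) (f := A.piecewise x y) (c := c + d)
    (hx.piecewise hA hy).aestronglyMeasurable (by
      filter_upwards [hc, hd, hXx, hYy] with ω h1 h2 h3 h4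
      by_cases h : ω ∈ A
      · rw [Set.piecewise_eq_of_mem _ _ _ h, ← h3]
        linarith
      · rw [Set.piecewise_eq_of_notMem _ _ _ h, ← h4]
        linarith)
  refine ⟨W, ?_, ?_⟩
  · filter_upwards [hW, hXx] with ω h1 h3 h2
    rw [h1, Set.piecewise_eq_of_mem _ _ _ h2, h3]
  · filter_upwards [hW, hYy] with ω h1 h3 h2
    rw [h1, Set.piecewise_eq_of_notMem _ _ _ h2, h3]

end Positions

namespace DynamicRiskMeasure

variable {Ω : Type*} {mΩ : MeasurableSpace Ω} {𝓕 : Filtration ℝ≥0 mΩ} {P : Measure Ω}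
  {σ τ : StoppingTime 𝓕} (ρ : DynamicRiskMeasure 𝓕 P) (h : σ ≤ τ)

theorem risk_mono_ae {X Y : Linf P τ} (hXY : (X : Lp ℝ ∞ P) ≤ᵐ[P] (Y : Lp ℝ ∞ P)) :
    (ρ.risk h Y : Lp ℝ ∞ P) ≤ᵐ[P] (ρ.risk h X : Lp ℝ ∞ P) :=
  (Lp.coeFn_le _ _).2 (ρ.monotone h X Y ((Lp.coeFn_le _ _).1 hXY))

theorem risk_add_ae (X : Linf P τ) (Z : Linf P σ) :
    (ρ.risk h (X + incl P h Z) : Lp ℝ ∞ P) =ᵐ[P]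
      fun ω => (ρ.risk h X : Lp ℝ ∞ P) ω - (Z : Lp ℝ ∞ P) ω := by
  rw [ρ.translation]
  exact Linf.coeFn_sub _ _

/-- If `X = Y` on `A ∈ 𝓕_σ`, then `X ≤ Y + c 1_{Aᶜ}` for a constant `c`, and monotonicity and
translation invariance compare the risks on `A`. -/
theorem risk_le_of_eqOn {A : Set Ω} (hA : MeasurableSet[sigmaAlg σ] A) {X Y : Linf P τ}
    (hXY : ∀ᵐ ω ∂P, ω ∈ A → (X : Lp ℝ ∞ P) ω = (Y : Lp ℝ ∞ P) ω) :
    ∀ᵐ ω ∂P, ω ∈ A → (ρ.risk h Y : Lp ℝ ∞ P) ω ≤ (ρ.risk h X : Lp ℝ ∞ P) ω := by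
  obtain ⟨c, hc0, hc⟩ := Linf.exists_bound X
  obtain ⟨d, hd0, hd⟩ := Linf.exists_bound Y
  obtain ⟨Z, hZ⟩ := Linf.exists_ae_eq (τ := σ) (P := P) (f := Aᶜ.indicator fun _ => c + d)
    (c := c + d) ((stronglyMeasurable_const.indicator hA.compl).aestronglyMeasurable)
    (Eventually.of_forall fun ω => by
      by_cases h : ω ∈ A
      · simp only [Set.mem_compl_iff, h, not_true_eq_false, not_false_eq_true,
          Set.indicator_of_notMem, abs_zero]
        positivity
      · simp only [Set.mem_compl_iff, h, not_false_eq_true, Set.indicator_of_mem]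
        rw [abs_of_nonneg (by positivity)])
  have h1 : (X : Lp ℝ ∞ P) ≤ᵐ[P] ((Y + incl P h Z : Linf P τ) : Lp ℝ ∞ P) := by
    filter_upwards [hXY, hc, hd, hZ, Linf.coeFn_add Y (incl P h Z)] with ω a1 a2 a3 a4 a5
    rw [a5, coe_incl, a4]
    by_cases h : ω ∈ A
    · simp [h, a1 h]
    · simp only [Set.mem_compl_iff, h, not_false_eq_true, Set.indicator_of_mem]
      linarith [(abs_le.1 a2).2, (abs_le.1 a3).1]
  filter_upwards [ρ.risk_mono_ae h h1, ρ.risk_add_ae h Y Z, hZ] with ω a1 a2 a3 hω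
  rw [a2, a3, Set.indicator_of_notMem (by simpa using hω)] at a1
  linarith

/-- Locality: on `A ∈ 𝓕_σ` the risk depends only on the restriction of the position to `A`. -/
theorem risk_eq_of_eqOn {A : Set Ω} (hA : MeasurableSet[sigmaAlg σ] A) {X Y : Linf P τ}
    (hXY : ∀ᵐ ω ∂P, ω ∈ A → (X : Lp ℝ ∞ P) ω = (Y : Lp ℝ ∞ P) ω) :
    ∀ᵐ ω ∂P, ω ∈ A → (ρ.risk h X : Lp ℝ ∞ P) ω = (ρ.risk h Y : Lp ℝ ∞ P) ω := by
  filter_upwards [ρ.risk_le_of_eqOn h hA hXY, ρ.risk_le_of_eqOn h hA (X := Y) (Y := X)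
    (hXY.mono fun ω h1 h2 => (h1 h2).symm)] with ω h1 h2 hω
  exact le_antisymm (h2 hω) (h1 hω)

variable {Q : Measure Ω}

theorem integrable_coe [IsProbabilityMeasure Q] (hQ : Q ≪ P) (X : Linf P τ) :
    Integrable (X : Lp ℝ ∞ P) Q := by
  obtain ⟨c, -, hc⟩ := Linf.exists_bound X
  exact Integrable.of_bound (Lp.stronglyMeasurable (X : Lp ℝ ∞ P)).aestronglyMeasurable c
    (hQ.ae_le hc)

theorem exists_bound_condExp_neg (m : MeasurableSpace Ω) (hQ : Q ≪ P) (X : Linf P τ) :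
    ∃ c : ℝ, ∀ᵐ ω ∂Q, |condExp m Q (fun ω' => -(X : Lp ℝ ∞ P) ω') ω| ≤ c := by
  obtain ⟨c, -, hc⟩ := Linf.exists_bound X
  refine ⟨c, ae_bdd_abs_condExp_of_ae_bdd_abs ?_⟩
  filter_upwards [hQ.ae_le hc] with ω hω
  rwa [abs_neg]

theorem exists_bound_gap (hQ : Q ≪ P) (X : Linf P τ) :
    ∃ c : ℝ, ∀ᵐ ω ∂Q, |condExp (sigmaAlg σ) Q (fun ω' => -(X : Lp ℝ ∞ P) ω') ω
      - (ρ.risk h X : Lp ℝ ∞ P) ω| ≤ c := by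
  obtain ⟨c, hc⟩ := exists_bound_condExp_neg (sigmaAlg σ) hQ X
  obtain ⟨d, -, hd⟩ := Linf.exists_bound (ρ.risk h X)
  refine ⟨c + d, ?_⟩
  filter_upwards [hc, hQ.ae_le hd] with ω a1 a2
  exact (abs_sub _ _).trans (add_le_add a1 a2)

variable [IsProbabilityMeasure Q]

theorem gap_eq_of_eqOn (hQ : Q ≪ P) {A : Set Ω} (hA : MeasurableSet[sigmaAlg σ] A)
    {X Y : Linf P τ} (hXY : ∀ᵐ ω ∂P, ω ∈ A → (X : Lp ℝ ∞ P) ω = (Y : Lp ℝ ∞ P) ω) :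
    ∀ᵐ ω ∂Q, ω ∈ A → ρ.gap h Q X ω = ρ.gap h Q Y ω := by
  have hA' : MeasurableSet A := sigmaAlg_le σ _ hA
  have h1 := condExp_ae_eq_restrict_zero (μ := Q) hA
    (f := (fun ω => -(X : Lp ℝ ∞ P) ω) - fun ω => -(Y : Lp ℝ ∞ P) ω) (by
      refine (ae_restrict_iff' hA').2 ?_
      filter_upwards [hQ.ae_le hXY] with ω h1 h2
      simp [h1 h2])
  rw [EventuallyEq, ae_restrict_iff' hA'] at h1
  filter_upwards [h1, condExp_sub (integrable_coe hQ X).neg (integrable_coe hQ Y).neg (sigmaAlg σ),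
    hQ.ae_le (ρ.risk_eq_of_eqOn h hA hXY)] with ω a1 a2 a3 hω
  have a4 := a1 hω
  have a5 : condExp (sigmaAlg σ) Q (fun ω => -(X : Lp ℝ ∞ P) ω) ω
      - condExp (sigmaAlg σ) Q (fun ω => -(Y : Lp ℝ ∞ P) ω) ω = 0 := by
    exact a2.symm.trans a4
  simp only [gap]
  rw [a3 hω, sub_eq_zero.1 a5]

/-- The family `E_Q(-X | 𝓕_σ) - ρ_{σ,τ}(X)` is directed upwards: paste `X` and `Y` along the event
where the first gap is the larger one. -/
theorem exists_gap_ge (hQ : Q ≪ P) (X Y : Linf P τ) :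
    ∃ W : Linf P τ, ρ.gap h Q X ≤ᵐ[Q] ρ.gap h Q W ∧ ρ.gap h Q Y ≤ᵐ[Q] ρ.gap h Q W := by
  obtain ⟨r, hr, hXr⟩ := Linf.aestronglyMeasurable (ρ.risk h X)
  obtain ⟨s, hs, hYs⟩ := Linf.aestronglyMeasurable (ρ.risk h Y)
  set A : Set Ω := {ω | condExp (sigmaAlg σ) Q (fun ω' => -(Y : Lp ℝ ∞ P) ω') ω - s ω ≤
    condExp (sigmaAlg σ) Q (fun ω' => -(X : Lp ℝ ∞ P) ω') ω - r ω} with hA_def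
  have hA : MeasurableSet[sigmaAlg σ] A :=
    measurableSet_le (stronglyMeasurable_condExp.sub hs).measurable
      (stronglyMeasurable_condExp.sub hr).measurable
  obtain ⟨W, hW1, hW2⟩ := Linf.exists_piecewise (sigmaAlg_mono h _ hA) X Y
  have h1 := ρ.gap_eq_of_eqOn h hQ hA hW1
  have h2 := ρ.gap_eq_of_eqOn h hQ hA.compl hW2
  have hX' : ∀ᵐ ω ∂Q, ω ∈ A ↔ ρ.gap h Q Y ω ≤ ρ.gap h Q X ω := by
    filter_upwards [hQ.ae_le hXr, hQ.ae_le hYs] with ω a1 a2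
    simp only [gap, EReal.coe_le_coe_iff, a1, a2, hA_def, Set.mem_ofPred_eq]
  refine ⟨W, ?_, ?_⟩
  · filter_upwards [h1, h2, hX'] with ω a1 a2 a3
    by_cases hω : ω ∈ A
    · rw [a1 hω]
    · rw [a2 hω]
      exact (not_le.1 (a3.not.1 hω)).le
  · filter_upwards [h1, h2, hX'] with ω a1 a2 a3
    by_cases hω : ω ∈ A
    · rw [a1 hω]
      exact a3.1 hω
    · rw [a2 hω]

end DynamicRiskMeasure

/-! ### Essential suprema of directed families -/

section EssSupSequence

variable {Ω ι : Type*} {mΩ : MeasurableSpace Ω} {Q : Measure Ω} [IsFiniteMeasure Q]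
  {f : ι → Ω → EReal} {g : Ω → EReal}

theorem exists_strictMono_measurable_le_one :
    ∃ φ : EReal → ℝ≥0∞, StrictMono φ ∧ Measurable φ ∧ ∀ x, φ x ≤ 1 := by
  have hs : StrictMono fun x : EReal =>
      ENNReal.ofReal (ENNReal.orderIsoUnitIntervalBirational (EReal.exp x) : ℝ) := by
    intro x y hxy
    have h1 : ((ENNReal.orderIsoUnitIntervalBirational (EReal.exp x)) : ℝ)
        < ENNReal.orderIsoUnitIntervalBirational (EReal.exp y) :=
      ENNReal.orderIsoUnitIntervalBirational.strictMono (EReal.exp_strictMono hxy)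
    have h2 := (ENNReal.orderIsoUnitIntervalBirational (EReal.exp x)).2.1
    exact (ENNReal.ofReal_lt_ofReal_iff (h2.trans_lt h1)).2 h1
  exact ⟨_, hs, hs.monotone.measurable, fun x =>
    ENNReal.ofReal_le_one.2 (ENNReal.orderIsoUnitIntervalBirational (EReal.exp x)).2.2⟩

/-- An essential supremum is almost everywhere the supremum of a countable subfamily: take a
countable set of indices that maximises the integral of a strictly increasing bounded transform. -/
theorem IsEssSup.exists_countable (hg : IsEssSup Q f g) (hf : ∀ i, Measurable (f i)) :
    ∃ s : Set ι, s.Countable ∧ g =ᵐ[Q] fun ω => ⨆ i ∈ s, f i ω := by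
  obtain ⟨φ, hφ, hφm, hφ1⟩ := exists_strictMono_measurable_le_one
  let G : Set ι → Ω → EReal := fun s ω => ⨆ i ∈ s, f i ω
  have hG : ∀ s : Set ι, s.Countable → Measurable (G s) := fun s hs =>
    Measurable.biSup s hs fun i _ => hf i
  have hGmono : ∀ s t : Set ι, s ⊆ t → ∀ ω, G s ω ≤ G t ω := fun s t h ω =>
    biSup_mono fun i hi => h hi
  let I : Set ι → ℝ≥0∞ := fun s => ∫⁻ ω, φ (G s ω) ∂Q
  have hfin : ∀ s, I s ≠ ∞ := fun s => by
    have h1 : I s ≤ ∫⁻ _, 1 ∂Q := lintegral_mono fun ω => hφ1 _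
    rw [lintegral_one] at h1
    exact ne_top_of_le_ne_top (measure_ne_top Q _) h1
  let V : Set ℝ≥0∞ := I '' {s : Set ι | s.Countable}
  obtain ⟨u, -, hu, huV⟩ := exists_seq_tendsto_sSup (S := V)
    ⟨I ∅, ∅, Set.countable_empty, rfl⟩ (OrderTop.bddAbove V)
  choose s hsc hsI using huV
  have hSc : (⋃ n, s n).Countable := Set.countable_iUnion hsc
  have hSI : sSup V ≤ I (⋃ n, s n) := le_of_tendsto' hu fun n => by
    rw [← hsI n]
    exact lintegral_mono fun ω => hφ.monotone (hGmono _ _ (Set.subset_iUnion s n) ω)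
  refine ⟨⋃ n, s n, hSc, ?_⟩
  have hle : g ≤ᵐ[Q] G (⋃ n, s n) := by
    refine hg.2.2 _ (hG _ hSc) fun i => ?_
    have hic : (insert i (⋃ n, s n)).Countable := hSc.insert i
    have h2 : (fun ω => φ (G (⋃ n, s n) ω)) =ᵐ[Q] fun ω => φ (G (insert i (⋃ n, s n)) ω) :=
      ae_eq_of_ae_le_of_lintegral_le
        (Eventually.of_forall fun ω => hφ.monotone (hGmono _ _ (Set.subset_insert i _) ω))
        (hfin _) (hφm.comp (hG _ hic)).aemeasurable
        ((le_sSup (Set.mem_image_of_mem I hic)).trans hSI)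
    filter_upwards [h2] with ω hω
    rw [hφ.injective hω]
    exact le_biSup (fun j => f j ω) (Set.mem_insert i _)
  have hge : ∀ᵐ ω ∂Q, ∀ i ∈ ⋃ n, s n, f i ω ≤ g ω := (ae_ball_iff hSc).2 fun i _ => hg.2.1 i
  filter_upwards [hle, hge] with ω h1 h2
  exact le_antisymm h1 (iSup₂_le h2)

/-- The essential supremum of a family directed upwards is the increasing limit of a sequence of its
members. -/
theorem IsEssSup.exists_seq_of_directed [Nonempty ι] (hg : IsEssSup Q f g)
    (hf : ∀ i, Measurable (f i))
    (hdir : ∀ i j, ∃ k, f i ≤ᵐ[Q] f k ∧ f j ≤ᵐ[Q] f k) :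
    ∃ u : ℕ → ι, ∀ᵐ ω ∂Q, Monotone (fun n => f (u n) ω) ∧
      Tendsto (fun n => f (u n) ω) atTop (𝓝 (g ω)) := by
  obtain ⟨s, hs, hgs⟩ := hg.exists_countable hf
  inhabit ι
  obtain ⟨v, hv⟩ := (hs.insert default).exists_eq_range ⟨_, Set.mem_insert default s⟩
  choose k hk1 hk2 using hdir
  let u : ℕ → ι := fun n => Nat.rec (v 0) (fun n i => k i (v (n + 1))) n
  have hmono : ∀ᵐ ω ∂Q, ∀ n, f (u n) ω ≤ f (u (n + 1)) ω := ae_all_iff.2 fun n => hk1 _ _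
  have hle : ∀ᵐ ω ∂Q, ∀ n, f (v n) ω ≤ f (u n) ω := ae_all_iff.2 fun n => by
    cases n with
    | zero => exact EventuallyLE.rfl
    | succ n => exact hk2 _ _
  have hub : ∀ᵐ ω ∂Q, ∀ n, f (u n) ω ≤ g ω := ae_all_iff.2 fun n => hg.2.1 _
  refine ⟨u, ?_⟩
  filter_upwards [hmono, hle, hub, hgs] with ω h1 h2 h3 h4
  have hm : Monotone fun n => f (u n) ω := monotone_nat_of_le_succ h1
  refine ⟨hm, ?_⟩
  have e : g ω = ⨆ n, f (u n) ω := by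
    refine le_antisymm ?_ (iSup_le h3)
    rw [h4]
    refine iSup₂_le fun i hi => ?_
    obtain ⟨n, rfl⟩ : i ∈ Set.range v := hv ▸ Set.mem_insert_of_mem _ hi
    exact (h2 n).trans (le_iSup (fun n => f (u n) ω) n)
  rw [e]
  exact tendsto_atTop_iSup hm

end EssSupSequence

namespace DynamicRiskMeasure

variable {Ω : Type*} {mΩ : MeasurableSpace Ω} {𝓕 : Filtration ℝ≥0 mΩ} {P : Measure Ω}
  {σ τ : StoppingTime 𝓕} (ρ : DynamicRiskMeasure 𝓕 P) (h : σ ≤ τ)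
  {Q : Measure Ω} [IsProbabilityMeasure Q]

theorem gap_le_penalty (X : Linf P τ) : ρ.gap h Q X ≤ᵐ[Q] ρ.penalty h Q :=
  (isEssSup_essSupFamily Q _ (ρ.measurable_gap h Q)).2.1 X

theorem measurable_penalty : Measurable (ρ.penalty h Q) :=
  (isEssSup_essSupFamily Q _ (ρ.measurable_gap h Q)).1

theorem exists_seq_gap_tendsto_penalty (hQ : Q ≪ P) :
    ∃ Y : ℕ → Linf P τ, ∀ᵐ ω ∂Q, Monotone (fun n => ρ.gap h Q (Y n) ω) ∧
      Tendsto (fun n => ρ.gap h Q (Y n) ω) atTop (𝓝 (ρ.penalty h Q ω)) :=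
  (isEssSup_essSupFamily Q _ (ρ.measurable_gap h Q)).exists_seq_of_directed
    (ρ.measurable_gap h Q) (ρ.exists_gap_ge h hQ)

end DynamicRiskMeasure

/-! ### Extended conditional expectations -/

section ExtendedCondExp

variable {Ω : Type*} {m mΩ : MeasurableSpace Ω} {Q : Measure Ω} [IsProbabilityMeasure Q]

/-- For `f` bounded below the difference defining `condExpect` can be replaced by a translation that
makes `f` nonnegative. -/
theorem condExpect_ae_eq_of_ge (hm : m ≤ mΩ) {f : Ω → EReal} (hf : Measurable f) {c : ℝ}
    (hc0 : 0 ≤ c) (hc : ∀ᵐ ω ∂Q, ((-c : ℝ) : EReal) ≤ f ω) :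
    condExpect m Q f =ᵐ[Q] fun ω =>
      (condLExp m Q (fun ω' => (f ω' + (c : EReal)).toENNReal) ω : EReal) - (c : EReal) := by
  have hpos : Measurable fun ω => (f ω).toENNReal := EReal.continuous_toENNReal.measurable.comp hf
  have hneg : Measurable fun ω => (-f ω).toENNReal :=
    EReal.continuous_toENNReal.measurable.comp (continuous_neg.measurable.comp hf)
  -- since `f + c ≥ 0`, the identity `(f + c) + f⁻ = f⁺ + c` holds in `[0, ∞]`
  have hsum : (fun ω => (f ω + (c : EReal)).toENNReal) + (fun ω => (-f ω).toENNReal) =ᵐ[Q]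
      (fun ω => (f ω).toENNReal) + fun _ => ENNReal.ofReal c := by
    filter_upwards [hc] with ω hω
    simp only [Pi.add_apply]
    induction h : f ω with
    | bot => simp [h] at hω
    | top => simp
    | coe x =>
      rw [h, EReal.coe_le_coe_iff] at hω
      rw [← EReal.coe_add, ← EReal.coe_neg]
      simp only [EReal.real_coe_toENNReal]
      rcases le_total 0 x with hx | hx
      · rw [ENNReal.ofReal_of_nonpos (p := -x) (by linarith), add_zero, ENNReal.ofReal_add hx hc0]
      · rw [ENNReal.ofReal_of_nonpos hx, zero_add, ← ENNReal.ofReal_add (by linarith) (by linarith)]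
        congr 1
        ring
  have hnegc : (fun ω => (-f ω).toENNReal) ≤ᵐ[Q] fun _ => ENNReal.ofReal c := by
    filter_upwards [hc] with ω hω
    rw [← EReal.real_coe_toENNReal]
    refine EReal.toENNReal_le_toENNReal ?_
    rw [EReal.neg_le, ← EReal.coe_neg]
    exact hω
  have hconst := condLExp_const (hm := hm) Q (ENNReal.ofReal c)
  filter_upwards [condLExp_congr_ae (mΩ := m) hsum,
    condLExp_add_right (mΩ := m) (fun ω => (f ω + (c : EReal)).toENNReal) hneg.aemeasurable,
    condLExp_add_left (mΩ := m) (fun _ => ENNReal.ofReal c) hpos.aemeasurable,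
    condLExp_mono (mΩ := m) hnegc] with ω h1 h2 h3 h4
  rw [h2, h3, Pi.add_apply, Pi.add_apply, hconst] at h1
  rw [hconst] at h4
  change (condLExp m Q (fun ω => (f ω).toENNReal) ω : EReal)
    - (condLExp m Q (fun ω => (-f ω).toENNReal) ω : EReal) = _
  generalize condLExp m Q (fun ω => (f ω).toENNReal) ω = a at *
  generalize condLExp m Q (fun ω => (-f ω).toENNReal) ω = d at *
  generalize condLExp m Q (fun ω => (f ω + (c : EReal)).toENNReal) ω = e at *
  lift d to ℝ≥0 using ne_top_of_le_ne_top ENNReal.ofReal_ne_top h4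
  have h5 : (e : EReal) + ((d : ℝ≥0∞) : EReal) = a + (c : EReal) := by
    have := congrArg ((↑) : ℝ≥0∞ → EReal) h1
    rwa [EReal.coe_ennreal_add, EReal.coe_ennreal_add, EReal.coe_ennreal_ofReal,
      max_eq_left hc0] at this
  have hd : ((d : ℝ≥0∞) : EReal) = ((d : ℝ) : EReal) := rfl
  rw [hd] at h5 ⊢
  rw [← EReal.add_sub_cancel_right (a := (a : EReal)) (b := c), ← h5, sub_eq_add_neg,
    sub_eq_add_neg, sub_eq_add_neg, add_assoc, add_assoc, ← EReal.coe_neg, ← EReal.coe_neg,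
    add_comm ((-c : ℝ) : EReal), ← add_assoc ((d : ℝ) : EReal), ← EReal.coe_add, add_neg_cancel,
    EReal.coe_zero, zero_add]

theorem condLExp_ofReal_add_const (hm : m ≤ mΩ) {u : Ω → ℝ} {c : ℝ} (hu : Integrable u Q)
    (hc : ∀ᵐ ω ∂Q, -c ≤ u ω) :
    ∀ᵐ ω ∂Q, -c ≤ condExp m Q u ω ∧ (condLExp m Q (fun ω => ENNReal.ofReal (u ω + c)) ω : EReal) =
      ((condExp m Q u ω : ℝ) : EReal) + (c : EReal) := by
  have h1 : 0 ≤ᵐ[Q] fun ω => u ω + c := by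
    filter_upwards [hc] with ω hω
    simp only [Pi.zero_apply]
    linarith
  have h2 := condExp_const (μ := Q) hm c
  filter_upwards [condLExp_ofReal m (hu.add (integrable_const c)) h1,
    condExp_add hu (integrable_const c) m, condExp_nonneg (m := m) h1] with ω a1 a2 a3
  have a4 : condExp m Q (fun ω => u ω + c) ω = condExp m Q u ω + c := by
    have := a2
    rw [Pi.add_apply, h2] at this
    exact this
  have a5 : condLExp m Q (fun ω => ENNReal.ofReal (u ω + c)) ω
      = ENNReal.ofReal (condExp m Q (fun ω => u ω + c) ω) := a1
  rw [Pi.zero_apply, a4] at a3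
  refine ⟨by linarith, ?_⟩
  rw [a5, a4, EReal.coe_ennreal_ofReal, max_eq_left a3, EReal.coe_add]

theorem condExp_le_condExpect (hm : m ≤ mΩ) {f : Ω → EReal} (hf : Measurable f) {u : Ω → ℝ}
    {c : ℝ} (hu : Integrable u Q) (hc : ∀ᵐ ω ∂Q, -c ≤ u ω)
    (huf : ∀ᵐ ω ∂Q, (u ω : EReal) ≤ f ω) :
    ∀ᵐ ω ∂Q, ((condExp m Q u ω : ℝ) : EReal) ≤ condExpect m Q f ω := by
  wlog hc0 : 0 ≤ c generalizing c
  · exact this (c := |c|) (hc.mono fun ω h => (neg_le_neg (le_abs_self c)).trans h) (abs_nonneg c)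
  have h1 : (fun ω => ENNReal.ofReal (u ω + c)) ≤ᵐ[Q] fun ω => (f ω + (c : EReal)).toENNReal := by
    filter_upwards [huf] with ω hω
    rw [← EReal.real_coe_toENNReal, EReal.coe_add]
    exact EReal.toENNReal_le_toENNReal (by gcongr)
  have h2 : ∀ᵐ ω ∂Q, ((-c : ℝ) : EReal) ≤ f ω := by
    filter_upwards [hc, huf] with ω a1 a2 using (EReal.coe_le_coe_iff.2 a1).trans a2
  filter_upwards [condExpect_ae_eq_of_ge hm hf hc0 h2, condLExp_ofReal_add_const hm hu hc,
    condLExp_mono (mΩ := m) h1] with ω a1 a2 a3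
  rw [a1, ← EReal.add_sub_cancel_right (a := ((condExp m Q u ω : ℝ) : EReal)) (b := c), ← a2.2]
  exact EReal.sub_le_sub (by exact_mod_cast a3) le_rfl

/-- The nontrivial half of monotone convergence for conditional expectations in `[0, ∞]`. -/
theorem condLExp_iSup_le {a : ℕ → Ω → ℝ≥0∞} (hm : m ≤ mΩ)
    (ha : ∀ n, AEMeasurable (a n) Q) (hmono : ∀ᵐ ω ∂Q, Monotone fun n => a n ω) :
    condLExp m Q (fun ω => ⨆ n, a n ω) ≤ᵐ[Q] fun ω => ⨆ n, condLExp m Q (a n) ω := by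
  have hmeas : ∀ n, Measurable[m] (condLExp m Q (a n)) := fun n => measurable_condLExp _ _ _
  apply ae_le_of_ae_le_trim (hm := hm)
  refine ae_le_of_forall_setLIntegral_le_of_sigmaFinite (μ := Q.trim hm)
    (measurable_condLExp _ _ _) fun s hs _ => ?_
  rw [setLIntegral_condLExp_trim hm _ _ hs, lintegral_iSup' (fun n => (ha n).restrict)
    (ae_restrict_of_ae hmono)]
  refine iSup_le fun n => ?_
  rw [← setLIntegral_condLExp_trim hm _ _ hs]
  exact lintegral_mono fun ω => le_iSup (fun n => condLExp m Q (a n) ω) n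

/-- Monotone convergence: an upper bound for the conditional expectations of an increasing sequence
is one for the conditional expectation of its limit. -/
theorem condExpect_le_of_tendsto (hm : m ≤ mΩ) {f : Ω → EReal} (hf : Measurable f)
    {u : ℕ → Ω → ℝ} {v : Ω → EReal} {c : ℝ} (hu : ∀ n, Integrable (u n) Q)
    (hc : ∀ᵐ ω ∂Q, -c ≤ u 0 ω)
    (huf : ∀ᵐ ω ∂Q, Monotone (fun n => u n ω) ∧
      Tendsto (fun n => (u n ω : EReal)) atTop (𝓝 (f ω)))
    (huv : ∀ n, ∀ᵐ ω ∂Q, ((condExp m Q (u n) ω : ℝ) : EReal) ≤ v ω) :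
    condExpect m Q f ≤ᵐ[Q] v := by
  wlog hc0 : 0 ≤ c generalizing c
  · exact this (c := |c|) (hc.mono fun ω h => (neg_le_neg (le_abs_self c)).trans h) (abs_nonneg c)
  have hcn : ∀ n, ∀ᵐ ω ∂Q, -c ≤ u n ω := fun n => by
    filter_upwards [hc, huf] with ω a1 a2 using a1.trans (a2.1 (Nat.zero_le n))
  have hlim : (fun ω => (f ω + (c : EReal)).toENNReal) =ᵐ[Q]
      fun ω => ⨆ n, ENNReal.ofReal (u n ω + c) := by
    filter_upwards [huf] with ω a1
    have h1 : Tendsto (fun n => ((u n ω : EReal) + (c : EReal)).toENNReal) atTop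
        (𝓝 (f ω + (c : EReal)).toENNReal) :=
      (EReal.continuous_toENNReal.tendsto _).comp
        ((EReal.continuousAt_add (Or.inr (EReal.coe_ne_bot c))
          (Or.inr (EReal.coe_ne_top c))).tendsto.comp (a1.2.prodMk_nhds tendsto_const_nhds))
    refine tendsto_nhds_unique h1 (tendsto_atTop_iSup (f := fun n => ENNReal.ofReal (u n ω + c)) ?_)
    intro i j hij
    exact ENNReal.ofReal_le_ofReal (by linarith [a1.1 hij])
  have h2 : ∀ᵐ ω ∂Q, ((-c : ℝ) : EReal) ≤ f ω := by
    filter_upwards [hc, huf] with ω a1 a2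
    have hm : Monotone fun n => (u n ω : EReal) := fun i j hij =>
      EReal.coe_le_coe_iff.2 (a2.1 hij)
    exact (EReal.coe_le_coe_iff.2 a1).trans (hm.ge_of_tendsto a2.2 0)
  have hsup := condLExp_iSup_le (m := m) (Q := Q) (a := fun n ω => ENNReal.ofReal (u n ω + c)) hm
    (fun n => ((hu n).aemeasurable.add_const c).ennreal_ofReal) (by
      filter_upwards [huf] with ω a1 i j hij
      exact ENNReal.ofReal_le_ofReal (by linarith [a1.1 hij]))
  filter_upwards [condExpect_ae_eq_of_ge hm hf hc0 h2, condLExp_congr_ae (mΩ := m) hlim, hsup,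
    ae_all_iff.2 fun n => condLExp_ofReal_add_const hm (hu n) (hcn n), ae_all_iff.2 huv]
    with ω a1 a2 a3 a4 a5
  have hn : ∀ n, (condLExp m Q (fun ω => ENNReal.ofReal (u n ω + c)) ω : EReal)
      ≤ v ω + (c : EReal) := fun n => by
    rw [(a4 n).2]
    gcongr
    exact a5 n
  have hpos : 0 ≤ v ω + (c : EReal) := (EReal.coe_ennreal_nonneg _).trans (hn 0)
  rw [a1]
  refine EReal.sub_le_of_le_add ?_
  rw [← EReal.coe_toENNReal hpos]
  rw [EReal.coe_ennreal_le_coe_ennreal_iff, a2]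
  refine a3.trans (iSup_le fun n => ?_)
  rw [← EReal.coe_ennreal_le_coe_ennreal_iff, EReal.coe_toENNReal hpos]
  exact hn n

end ExtendedCondExp

namespace DynamicRiskMeasure

variable {Ω : Type*} {mΩ : MeasurableSpace Ω} {𝓕 : Filtration ℝ≥0 mΩ} {P : Measure Ω}
  {ν σ τ : StoppingTime 𝓕} (ρ : DynamicRiskMeasure 𝓕 P)

/-! ### Consequences of time consistency -/

section Penalty

variable {Q : Measure Ω} [IsProbabilityMeasure Q]

theorem condExp_neg_add_incl (h : σ ≤ τ) (hQ : Q ≪ P) (X : Linf P τ) (Z : Linf P σ) :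
    condExp (sigmaAlg σ) Q (fun ω => -((X + incl P h Z : Linf P τ) : Lp ℝ ∞ P) ω) =ᵐ[Q]
      fun ω => condExp (sigmaAlg σ) Q (fun ω' => -(X : Lp ℝ ∞ P) ω') ω - (Z : Lp ℝ ∞ P) ω := by
  have h1 : (fun ω => -((X + incl P h Z : Linf P τ) : Lp ℝ ∞ P) ω) =ᵐ[Q]
      (fun ω => -(X : Lp ℝ ∞ P) ω) - (Z : Lp ℝ ∞ P) := by
    filter_upwards [hQ.ae_le (Linf.coeFn_add X (incl P h Z))] with ω hω
    rw [hω, coe_incl, Pi.sub_apply]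
    ring
  have hZ : condExp (sigmaAlg σ) Q (Z : Lp ℝ ∞ P) =ᵐ[Q] (Z : Lp ℝ ∞ P) :=
    condExp_of_aestronglyMeasurable' (sigmaAlg_le σ) ((Linf.aestronglyMeasurable Z).mono_ac hQ)
      (integrable_coe hQ Z)
  filter_upwards [condExp_congr_ae (m := sigmaAlg σ) h1, hZ,
    condExp_sub (integrable_coe hQ X).neg (integrable_coe hQ Z) (sigmaAlg σ)] with ω a1 a2 a3
  rw [a1, ← a2]
  exact a3

theorem measurable_risk_add_penalty (h : σ ≤ τ) (X : Linf P τ) :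
    Measurable fun ω => (((ρ.risk h X : Lp ℝ ∞ P) ω : ℝ) : EReal) + ρ.penalty h Q ω :=
  (measurable_coe_real_ereal.comp (Lp.stronglyMeasurable (ρ.risk h X : Lp ℝ ∞ P)).measurable).add
    (ρ.measurable_penalty h)

variable {ρ} in
/-- Time consistency implies the inequality between risks and penalties. In a sequence `Y_n` whose
gaps increase to `α_{σ,τ}(Q)`, each position may be shifted by an `𝓕_σ`-measurable one so that
`ρ_{σ,τ}(Y_n) = ρ_{σ,τ}(X)`, without changing its gap; time consistency then gives
`ρ_{ν,τ}(Y_n) = ρ_{ν,τ}(X)`. Hence `ρ_{σ,τ}(X) + α_{σ,τ}(Q)` is the increasing limit of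
`E_Q(-Y_n | 𝓕_σ)`, and `E_Q(-Y_n | 𝓕_ν) ≤ ρ_{ν,τ}(X) + α_{ν,τ}(Q)` by definition of the penalty. -/
theorem TimeConsistent.condExpect_le (hρ : ρ.TimeConsistent) (hνσ : ν ≤ σ) (hστ : σ ≤ τ)
    (hQ : Q ≪ P) (X : Linf P τ) :
    condExpect (sigmaAlg ν) Q
        (fun ω => (((ρ.risk hστ X : Lp ℝ ∞ P) ω : ℝ) : EReal) + ρ.penalty hστ Q ω)
      ≤ᵐ[Q] fun ω => (((ρ.risk (hνσ.trans hστ) X : Lp ℝ ∞ P) ω : ℝ) : EReal)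
        + ρ.penalty (hνσ.trans hστ) Q ω := by
  obtain ⟨Y, hY⟩ := ρ.exists_seq_gap_tendsto_penalty hστ hQ
  let Y' : ℕ → Linf P τ := fun n => Y n + incl P hστ (ρ.risk hστ (Y n) - ρ.risk hστ X)
  have hrisk : ∀ n, ρ.risk hστ (Y' n) = ρ.risk hστ X := fun n => by
    simp only [Y', ρ.translation, sub_sub_cancel]
  have hrisk' : ∀ n, ρ.risk (hνσ.trans hστ) (Y' n) = ρ.risk (hνσ.trans hστ) X := fun n => by
    rw [← hρ ν σ τ hνσ hστ, ← hρ ν σ τ hνσ hστ, hrisk]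
  let u : ℕ → Ω → ℝ := fun n ω => condExp (sigmaAlg σ) Q (fun ω' => -(Y' n : Lp ℝ ∞ P) ω') ω
  have hu : ∀ᵐ ω ∂Q, ∀ n, (u n ω : EReal) =
      (((ρ.risk hστ X : Lp ℝ ∞ P) ω : ℝ) : EReal) + ρ.gap hστ Q (Y n) ω := by
    refine ae_all_iff.2 fun n => ?_
    filter_upwards [condExp_neg_add_incl hστ hQ (Y n) (ρ.risk hστ (Y n) - ρ.risk hστ X),
      hQ.ae_le (Linf.coeFn_sub (ρ.risk hστ (Y n)) (ρ.risk hστ X))] with ω a1 a2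
    rw [gap, ← EReal.coe_add, EReal.coe_eq_coe_iff]
    refine a1.trans ?_
    rw [a2]
    ring
  obtain ⟨c, hc⟩ := exists_bound_condExp_neg (sigmaAlg σ) hQ (Y' 0)
  refine condExpect_le_of_tendsto (sigmaAlg_le ν) (ρ.measurable_risk_add_penalty hστ X)
    (u := u) (c := c) (fun n => integrable_condExp)
    (hc.mono fun ω hω => (abs_le.1 hω).1) ?_ fun n => ?_
  · filter_upwards [hY, hu] with ω a1 a2
    constructor
    · intro i j hij
      have h1 := a1.1 hij
      rw [← EReal.coe_le_coe_iff, a2 i, a2 j]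
      gcongr
    · simp only [a2]
      exact (EReal.continuousAt_add (Or.inl (EReal.coe_ne_top _))
        (Or.inl (EReal.coe_ne_bot _))).tendsto.comp (tendsto_const_nhds.prodMk_nhds a1.2)
  · filter_upwards [ρ.gap_le_penalty (hνσ.trans hστ) (Q := Q) (Y' n),
      condExp_condExp_of_le (μ := Q) (f := fun ω' => -(Y' n : Lp ℝ ∞ P) ω')
        (sigmaAlg_mono hνσ) (sigmaAlg_le σ)] with ω a1 a2
    rw [show condExp (sigmaAlg ν) Q (u n) ω
      = (ρ.risk (hνσ.trans hστ) X : Lp ℝ ∞ P) ω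
        + (condExp (sigmaAlg ν) Q (fun ω' => -(Y' n : Lp ℝ ∞ P) ω') ω
          - (ρ.risk (hνσ.trans hστ) X : Lp ℝ ∞ P) ω) by rw [add_sub_cancel]; exact a2,
      EReal.coe_add]
    rw [gap, hrisk' n] at a1
    gcongr

variable {ρ} in
theorem TimeConsistent.risk_eq (hρ : ρ.TimeConsistent) (hνσ : ν ≤ σ) (hστ : σ ≤ τ)
    (Z : Linf P σ) :
    ρ.risk hνσ Z =
      ρ.risk (hνσ.trans hστ) (incl P hστ Z + incl P hστ (ρ.risk hστ 0)) := by
  rw [← hρ ν σ τ hνσ hστ, ← map_add]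
  have h1 := ρ.translation hστ (Z + ρ.risk hστ 0) 0
  rw [zero_add] at h1
  rw [h1, sub_add_cancel_right, neg_neg]

end Penalty

/-! ### The expected risk -/

section Representation

theorem exists_const (τ : StoppingTime 𝓕) (c : ℝ) :
    ∃ K : Linf P τ, (K : Lp ℝ ∞ P) =ᵐ[P] fun _ => c :=
  Linf.exists_ae_eq (c := |c|) aestronglyMeasurable_const (Eventually.of_forall fun _ => le_rfl)

variable [IsProbabilityMeasure P]

theorem integrable_coe_self (X : Linf P τ) : Integrable (X : Lp ℝ ∞ P) P :=
  integrable_coe Measure.AbsolutelyContinuous.rfl X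

theorem integral_risk_mono (h : ν ≤ τ) {X Y : Linf P τ}
    (hXY : (X : Lp ℝ ∞ P) ≤ᵐ[P] (Y : Lp ℝ ∞ P)) :
    ∫ ω, (ρ.risk h Y : Lp ℝ ∞ P) ω ∂P ≤ ∫ ω, (ρ.risk h X : Lp ℝ ∞ P) ω ∂P :=
  integral_mono_ae (integrable_coe_self _) (integrable_coe_self _) (ρ.risk_mono_ae h hXY)

theorem integral_risk_add (h : ν ≤ τ) (X : Linf P τ) (Z : Linf P ν) :
    ∫ ω, (ρ.risk h (X + incl P h Z) : Lp ℝ ∞ P) ω ∂P =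
      ∫ ω, (ρ.risk h X : Lp ℝ ∞ P) ω ∂P - ∫ ω, (Z : Lp ℝ ∞ P) ω ∂P := by
  rw [integral_congr_ae (ρ.risk_add_ae h X Z),
    integral_sub (integrable_coe_self _) (integrable_coe_self _)]

theorem integral_risk_convex (h : ν ≤ τ) (X Y : Linf P τ) {a b : ℝ} (ha : 0 ≤ a) (hb : 0 ≤ b)
    (hab : a + b = 1) :
    ∫ ω, (ρ.risk h (a • X + b • Y) : Lp ℝ ∞ P) ω ∂P ≤
      a * ∫ ω, (ρ.risk h X : Lp ℝ ∞ P) ω ∂P + b * ∫ ω, (ρ.risk h Y : Lp ℝ ∞ P) ω ∂P := by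
  obtain rfl : b = 1 - a := by linarith
  rw [← integral_const_mul, ← integral_const_mul, ← integral_add
    ((integrable_coe_self _).const_mul _) ((integrable_coe_self _).const_mul _)]
  refine integral_mono_ae (integrable_coe_self _)
    (((integrable_coe_self _).const_mul _).add ((integrable_coe_self _).const_mul _)) ?_
  filter_upwards [(Lp.coeFn_le _ _).2 (ρ.convex h X Y a ha (by linarith)),
    Linf.coeFn_add (a • ρ.risk h X) ((1 - a) • ρ.risk h Y), Linf.coeFn_smul a (ρ.risk h X),
    Linf.coeFn_smul (1 - a) (ρ.risk h Y)] with ω a1 a2 a3 a4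
  rw [a2, a3, a4] at a1
  exact a1

variable {ρ} in
/-- Fatou property of the expected risk: it is lower semicontinuous along bounded sequences that
converge almost surely. The tail suprema of the sequence are larger positions, and they decrease to
the limit. -/
theorem ContinuousFromAbove.integral_risk_le_of_tendsto (hρ : ρ.ContinuousFromAbove) (h : ν ≤ τ)
    {X : ℕ → Linf P τ} {X' : Linf P τ} {c a : ℝ}
    (hc : ∀ n, ∀ᵐ ω ∂P, |(X n : Lp ℝ ∞ P) ω| ≤ c)
    (hlim : ∀ᵐ ω ∂P, Tendsto (fun n => (X n : Lp ℝ ∞ P) ω) atTop (𝓝 ((X' : Lp ℝ ∞ P) ω)))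
    (ha : ∀ n, ∫ ω, (ρ.risk h (X n) : Lp ℝ ∞ P) ω ∂P ≤ a) :
    ∫ ω, (ρ.risk h X' : Lp ℝ ∞ P) ω ∂P ≤ a := by
  choose x hx hXx using fun n => Linf.aestronglyMeasurable (X n)
  -- the tail suprema decrease to the limit
  let s : ℕ → Ω → ℝ := fun n ω => ⨆ m, x (n + m) ω
  have hs : ∀ n, Measurable[sigmaAlg τ] (s n) := fun n =>
    Measurable.iSup fun m => (hx (n + m)).measurable
  have hxc : ∀ᵐ ω ∂P, ∀ n, |x n ω| ≤ c := ae_all_iff.2 fun n => by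
    filter_upwards [hc n, hXx n] with ω a1 a2
    rwa [← a2]
  have hbdd : ∀ᵐ ω ∂P, ∀ n, BddAbove (Set.range fun m => x (n + m) ω) := by
    filter_upwards [hxc] with ω a1 n
    exact ⟨c, by rintro _ ⟨m, rfl⟩; exact (abs_le.1 (a1 _)).2⟩
  have hxs : ∀ᵐ ω ∂P, ∀ n, x n ω ≤ s n ω := by
    filter_upwards [hbdd] with ω a1 n using le_ciSup (a1 n) 0
  have hsc : ∀ᵐ ω ∂P, ∀ n, |s n ω| ≤ c := by
    filter_upwards [hxc, hxs] with ω a1 a2 n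
    exact abs_le.2 ⟨(abs_le.1 (a1 n)).1.trans (a2 n), ciSup_le fun m => (abs_le.1 (a1 _)).2⟩
  have hanti : ∀ᵐ ω ∂P, Antitone fun n => s n ω := by
    filter_upwards [hbdd] with ω a1
    refine antitone_nat_of_succ_le fun n => ciSup_le fun m => ?_
    have := le_ciSup (a1 n) (m + 1)
    rwa [show n + (m + 1) = n + 1 + m by ring] at this
  have hslim : ∀ᵐ ω ∂P, Tendsto (fun n => s n ω) atTop (𝓝 ((X' : Lp ℝ ∞ P) ω)) := by
    filter_upwards [hlim, ae_all_iff.2 hXx, hxs, hbdd] with ω a1 a2 a3 a4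
    simp only [a2] at a1
    refine tendsto_order.2 ⟨fun b hb => ?_, fun b hb => ?_⟩
    · filter_upwards [a1.eventually_const_lt hb] with n hn using hn.trans_le (a3 n)
    · obtain ⟨b', hb', hb'b⟩ := exists_between hb
      obtain ⟨N, hN⟩ := eventually_atTop.1 (a1.eventually_lt_const hb')
      filter_upwards [eventually_ge_atTop N] with n hn
      exact (ciSup_le fun m => (hN _ (by omega)).le).trans_lt hb'b
  choose S hS using fun n => Linf.exists_ae_eq (τ := τ) (P := P)
    (hs n).stronglyMeasurable.aestronglyMeasurable (c := c) (hsc.mono fun ω h => h n)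
  have hSdec : ∀ n, (S (n + 1) : Lp ℝ ∞ P) ≤ S n := fun n => (Lp.coeFn_le _ _).1 (by
    filter_upwards [hS n, hS (n + 1), hanti] with ω a1 a2 a3
    rw [a1, a2]
    exact a3 n.le_succ)
  have hSlim : ∀ᵐ ω ∂P, Tendsto (fun n => (S n : Lp ℝ ∞ P) ω) atTop
      (𝓝 ((X' : Lp ℝ ∞ P) ω)) := by
    filter_upwards [hslim, ae_all_iff.2 hS] with ω a1 a2
    simpa only [a2] using a1
  have hrisk := hρ ν τ h S X' hSdec hSlim
  have hdom : ∀ n, ∀ᵐ ω ∂P, ‖(ρ.risk h (S n) : Lp ℝ ∞ P) ω‖ ≤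
      |(ρ.risk h (S 0) : Lp ℝ ∞ P) ω| + |(ρ.risk h X' : Lp ℝ ∞ P) ω| := fun n => by
    have h1 : (S n : Lp ℝ ∞ P) ≤ᵐ[P] (S 0 : Lp ℝ ∞ P) := by
      filter_upwards [hS n, hS 0, hanti] with ω a1 a2 a3
      rw [a1, a2]
      exact a3 n.zero_le
    have h2 : (X' : Lp ℝ ∞ P) ≤ᵐ[P] (S n : Lp ℝ ∞ P) := by
      filter_upwards [hS n, hslim, hanti] with ω a1 a2 a3
      rw [a1]
      exact a3.le_of_tendsto a2 n
    filter_upwards [ρ.risk_mono_ae h h1, ρ.risk_mono_ae h h2] with ω a1 a2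
    rw [Real.norm_eq_abs]
    refine abs_le.2 ⟨?_, ?_⟩
    · linarith [neg_abs_le ((ρ.risk h (S 0) : Lp ℝ ∞ P) ω),
        abs_nonneg ((ρ.risk h X' : Lp ℝ ∞ P) ω)]
    · linarith [le_abs_self ((ρ.risk h X' : Lp ℝ ∞ P) ω),
        abs_nonneg ((ρ.risk h (S 0) : Lp ℝ ∞ P) ω)]
  have hint := tendsto_integral_of_dominated_convergence _
    (fun n => (integrable_coe_self (ρ.risk h (S n))).aestronglyMeasurable)
    ((integrable_coe_self (ρ.risk h (S 0))).abs.add (integrable_coe_self (ρ.risk h X')).abs)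
    hdom hrisk
  refine le_of_tendsto' hint fun n => (ρ.integral_risk_mono h ?_).trans (ha n)
  filter_upwards [hS n, hXx n, hxs] with ω a1 a2 a3
  rw [a1, a2]
  exact a3 n

end Representation

end DynamicRiskMeasure

namespace DynamicRiskMeasure

variable {Ω : Type*} {mΩ : MeasurableSpace Ω} {𝓕 : Filtration ℝ≥0 mΩ} {P : Measure Ω}
  {ν σ τ : StoppingTime 𝓕} {ρ : DynamicRiskMeasure 𝓕 P}

/-! ### Dual representation of the expected risk -/

/-- The differences `X - Y`, as elements of `L²`, where `X` ranges over the positions in `L^∞(𝓕_τ)`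
with expected risk at most `a`. -/
def shiftedAcceptance (ρ : DynamicRiskMeasure 𝓕 P) (h : ν ≤ τ) (Y : Linf P τ) (a : ℝ) :
    Set (Lp ℝ 2 P) :=
  {f | ∃ X : Linf P τ, ∫ ω, (ρ.risk h X : Lp ℝ ∞ P) ω ∂P ≤ a ∧
    f =ᵐ[P] fun ω => (X : Lp ℝ ∞ P) ω - (Y : Lp ℝ ∞ P) ω}

theorem exists_mem_essBall_of_mem_shiftedAcceptance (h : ν ≤ τ) (Y : Linf P τ) (a : ℝ)
    {f : Lp ℝ 2 P} (hf : f ∈ ρ.shiftedAcceptance h Y a) : ∃ R, f ∈ essBall P R := by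
  obtain ⟨X, -, hfX⟩ := hf
  obtain ⟨c, -, hc⟩ := Linf.exists_bound X
  obtain ⟨d, -, hd⟩ := Linf.exists_bound Y
  refine ⟨c + d, ?_⟩
  filter_upwards [hfX, hc, hd] with ω a1 a2 a3
  rw [a1]
  exact (abs_sub _ _).trans (add_le_add a2 a3)

variable [IsProbabilityMeasure P]

theorem convex_shiftedAcceptance (h : ν ≤ τ) (Y : Linf P τ) (a : ℝ) :
    Convex ℝ (ρ.shiftedAcceptance h Y a) := by
  rintro f ⟨X, hX, hfX⟩ f' ⟨X', hX', hfX'⟩ s t hs ht hst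
  refine ⟨s • X + t • X', (ρ.integral_risk_convex h X X' hs ht hst).trans ?_, ?_⟩
  · calc _ ≤ s * a + t * a := by gcongr
      _ = a := by rw [← add_mul, hst, one_mul]
  · filter_upwards [hfX, hfX', Lp.coeFn_add (s • f) (t • f'), Lp.coeFn_smul s f,
      Lp.coeFn_smul t f', Linf.coeFn_add (s • X) (t • X'), Linf.coeFn_smul s X,
      Linf.coeFn_smul t X'] with ω a1 a2 a3 a4 a5 a6 a7 a8
    rw [a3, Pi.add_apply, a4, a5, a6, a7, a8, Pi.smul_apply, Pi.smul_apply, a1, a2, smul_eq_mul,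
      smul_eq_mul]
    linear_combination -((Y : Lp ℝ ∞ P) ω) * hst

theorem isClosed_essBall (R : ℝ) : IsClosed (essBall P R) :=
  isClosed_essCone.preimage (by fun_prop : Continuous fun f : Lp ℝ 2 P => (f, R))

theorem ContinuousFromAbove.isClosed_shiftedAcceptance_inter (hρ : ρ.ContinuousFromAbove)
    (h : ν ≤ τ) (Y : Linf P τ) (a R : ℝ) :
    IsClosed (ρ.shiftedAcceptance h Y a ∩ essBall P R) := by
  refine IsSeqClosed.isClosed fun f f' hf hlim => ?_
  have hf'R : f' ∈ essBall P R :=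
    (isClosed_essBall R).mem_of_tendsto hlim (Eventually.of_forall fun n => (hf n).2)
  refine ⟨?_, hf'R⟩
  choose X hX hfX using fun n => (hf n).1
  obtain ⟨d, -, hd⟩ := Linf.exists_bound Y
  have hmeas : AEStronglyMeasurable[sigmaAlg τ] f' P :=
    (isClosed_aestronglyMeasurable (F := ℝ) (p := 2) (μ := P) (sigmaAlg_le τ)).mem_of_tendsto hlim
      (Eventually.of_forall fun n => ((Linf.aestronglyMeasurable (X n)).sub
        (Linf.aestronglyMeasurable Y)).congr (hfX n).symm)
  obtain ⟨X', hX'⟩ := Linf.exists_ae_eq (τ := τ) (P := P) (c := R + d)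
    (hmeas.add (Linf.aestronglyMeasurable Y)) (by
      filter_upwards [mem_essBall.1 hf'R, hd] with ω a1 a2
      exact (abs_add_le _ _).trans (add_le_add a1 a2))
  obtain ⟨φ, -, hφ⟩ := (tendstoInMeasure_of_tendsto_Lp hlim).exists_seq_tendsto_ae
  refine ⟨X', hρ.integral_risk_le_of_tendsto h (X := fun n => X (φ n)) (c := R + d)
    (fun n => ?_) ?_ fun n => hX _, ?_⟩
  · filter_upwards [hfX (φ n), mem_essBall.1 (hf (φ n)).2, hd] with ω a1 a2 a3
    rw [a1] at a2
    have := (abs_add_le _ _).trans (add_le_add a2 a3)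
    rwa [sub_add_cancel] at this
  · filter_upwards [hφ, ae_all_iff.2 hfX, hX'] with ω a1 a2 a3
    rw [a3]
    refine (a1.add_const ((Y : Lp ℝ ∞ P) ω)).congr fun n => ?_
    rw [a2, sub_add_cancel]
  · filter_upwards [hX'] with ω a1
    rw [a1, Pi.add_apply, add_sub_cancel_right]

theorem integrable_mul_coe {g : Ω → ℝ} (hg : Integrable g P) (X : Linf P τ) :
    Integrable (fun ω => g ω * (X : Lp ℝ ∞ P) ω) P := by
  obtain ⟨c, -, hc⟩ := Linf.exists_bound X
  exact hg.mul_bdd (integrable_coe_self X).aestronglyMeasurable hc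

theorem integral_condExp_mul {g : Ω → ℝ} (hg : Integrable g P) (X : Linf P τ) :
    ∫ ω, condExp (sigmaAlg τ) P g ω * (X : Lp ℝ ∞ P) ω ∂P = ∫ ω, g ω * (X : Lp ℝ ∞ P) ω ∂P := by
  have := condExp_mul_of_aestronglyMeasurable_right (Linf.aestronglyMeasurable X)
    (integrable_mul_coe hg X) hg
  rw [← integral_condExp (sigmaAlg_le τ) (f := fun ω => g ω * (X : Lp ℝ ∞ P) ω)]
  exact (integral_congr_ae this).symm

theorem integral_risk_add_const (h : ν ≤ τ) (X : Linf P τ) (c : ℝ) :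
    ∃ X' : Linf P τ, ((X' : Lp ℝ ∞ P) =ᵐ[P] fun ω => (X : Lp ℝ ∞ P) ω + c) ∧
      ∫ ω, (ρ.risk h X' : Lp ℝ ∞ P) ω ∂P = ∫ ω, (ρ.risk h X : Lp ℝ ∞ P) ω ∂P - c := by
  obtain ⟨K, hK⟩ := exists_const (P := P) ν c
  refine ⟨X + incl P h K, ?_, ?_⟩
  · filter_upwards [hK, Linf.coeFn_add X (incl P h K)] with ω a1 a2
    rw [a2, coe_incl, a1]
  · rw [ρ.integral_risk_add h X K, integral_congr_ae hK, integral_const]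
    simp

/-- Dual representation of the convex functional `X ↦ E_P(ρ_{ν,τ}(X))` up to `ε`: some probability
density is an `ε`-subgradient at `Y`. The density separates `Y` from the positions whose expected
risk is at most `E_P(ρ_{ν,τ}(Y)) - ε`. -/
theorem ContinuousFromAbove.exists_density (hρ : ρ.ContinuousFromAbove) (h : ν ≤ τ)
    (Y : Linf P τ) {ε : ℝ} (hε : 0 < ε) :
    ∃ g : Ω → ℝ, Integrable g P ∧ Measurable g ∧ (∀ᵐ ω ∂P, 0 ≤ g ω) ∧ ∫ ω, g ω ∂P = 1 ∧
      ∀ X : Linf P τ, -∫ ω, g ω * (X : Lp ℝ ∞ P) ω ∂P - ∫ ω, (ρ.risk h X : Lp ℝ ∞ P) ω ∂P ≤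
        -∫ ω, g ω * (Y : Lp ℝ ∞ P) ω ∂P - ∫ ω, (ρ.risk h Y : Lp ℝ ∞ P) ω ∂P + ε := by
  set a : ℝ := ∫ ω, (ρ.risk h Y : Lp ℝ ∞ P) ω ∂P - ε with ha
  obtain ⟨g₀, hg₀, hsep₀⟩ := exists_integrable_separating
    (ρ.convex_shiftedAcceptance h Y a)
    (fun f => ρ.exists_mem_essBall_of_mem_shiftedAcceptance h Y a)
    (hρ.isClosed_shiftedAcceptance_inter h Y a) (by
      rintro ⟨X, hX, h0⟩
      have : X = Y := Linf.ext_ae (by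
        filter_upwards [h0, Lp.coeFn_zero ℝ 2 P] with ω a1 a2
        rw [a2, Pi.zero_apply] at a1
        linarith)
      rw [this] at hX
      linarith)
  -- only the `𝓕_τ`-measurable part of the density is seen by the positions, and only that part is
  -- nonnegative by monotonicity
  set g : Ω → ℝ := condExp (sigmaAlg τ) P g₀ with hg_def
  have hg : Integrable g P := integrable_condExp
  have hgm : StronglyMeasurable[sigmaAlg τ] g := stronglyMeasurable_condExp
  have hsep : ∀ X : Linf P τ, ∫ ω, (ρ.risk h X : Lp ℝ ∞ P) ω ∂P ≤ a →
      1 ≤ ∫ ω, g ω * (X : Lp ℝ ∞ P) ω ∂P - ∫ ω, g ω * (Y : Lp ℝ ∞ P) ω ∂P := by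
    intro X hX
    obtain ⟨c, -, hc⟩ := Linf.exists_bound X
    obtain ⟨d, -, hd⟩ := Linf.exists_bound Y
    have hm : MemLp (fun ω => (X : Lp ℝ ∞ P) ω - (Y : Lp ℝ ∞ P) ω) 2 P :=
      MemLp.of_bound ((integrable_coe_self X).sub (integrable_coe_self Y)).aestronglyMeasurable
        (c + d) (by
          filter_upwards [hc, hd] with ω a2 a3
          exact (abs_sub _ _).trans (add_le_add a2 a3))
    have h1 := hsep₀ (hm.toLp _) ⟨X, hX, hm.coeFn_toLp⟩
    rw [integral_condExp_mul hg₀, integral_condExp_mul hg₀,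
      ← integral_sub (integrable_mul_coe hg₀ X) (integrable_mul_coe hg₀ Y)]
    refine h1.trans (le_of_eq (integral_congr_ae ?_))
    filter_upwards [hm.coeFn_toLp] with ω a1
    rw [a1, mul_sub]
  have hadd : ∀ (X X' : Linf P τ) (c : ℝ), ((X' : Lp ℝ ∞ P) =ᵐ[P] fun ω => (X : Lp ℝ ∞ P) ω + c) →
      ∫ ω, g ω * (X' : Lp ℝ ∞ P) ω ∂P = ∫ ω, g ω * (X : Lp ℝ ∞ P) ω ∂P + c * ∫ ω, g ω ∂P := by
    intro X X' c hX'
    rw [← integral_const_mul, ← integral_add (integrable_mul_coe hg X) (hg.const_mul c)]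
    refine integral_congr_ae ?_
    filter_upwards [hX'] with ω a1
    rw [a1]
    ring
  obtain ⟨Y₁, hY₁, hY₁r⟩ := integral_risk_add_const (ρ := ρ) h Y ε
  -- adding `t 1_A` to `Y + ε` does not increase the risk, for all `t ≥ 0`
  have hgA : ∀ A : Set Ω, MeasurableSet[sigmaAlg τ] A → 0 ≤ ∫ ω in A, g ω ∂P := by
    intro A hA
    by_contra! hneg
    have hA' := sigmaAlg_le τ _ hA
    have key : ∀ t : ℝ, 0 ≤ t → 1 ≤ ε * ∫ ω, g ω ∂P + t * ∫ ω in A, g ω ∂P := by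
      intro t ht
      obtain ⟨I, hI⟩ := Linf.exists_ae_eq (τ := τ) (P := P) (f := A.indicator fun _ => t) (c := t)
        (stronglyMeasurable_const.indicator hA).aestronglyMeasurable
        (Eventually.of_forall fun ω => by
          by_cases h : ω ∈ A
          · simp [h, abs_of_nonneg ht]
          · simp [h, ht])
      have h1 := hsep (Y₁ + I) ((ρ.integral_risk_mono h (by
        filter_upwards [Linf.coeFn_add Y₁ I, hI] with ω a1 a2
        rw [a1, a2]
        have : 0 ≤ A.indicator (fun _ => t) ω := Set.indicator_nonneg (fun _ _ => ht) ω
        linarith)).trans hY₁r.le)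
      have h2 : ∫ ω, g ω * ((Y₁ + I : Linf P τ) : Lp ℝ ∞ P) ω ∂P
          = ∫ ω, g ω * (Y₁ : Lp ℝ ∞ P) ω ∂P + t * ∫ ω in A, g ω ∂P := by
        rw [← integral_indicator hA', ← integral_const_mul,
          ← integral_add (integrable_mul_coe hg Y₁) ((hg.indicator hA').const_mul t)]
        refine integral_congr_ae ?_
        filter_upwards [Linf.coeFn_add Y₁ I, hI] with ω a1 a2
        rw [a1, a2]
        by_cases h : ω ∈ A
        · simp only [h, Set.indicator_of_mem]
          ring
        · simp [h]
      rw [h2, hadd Y Y₁ ε hY₁] at h1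
      linarith
    have h3 := key (|ε * ∫ ω, g ω ∂P| / (-∫ ω in A, g ω ∂P))
      (div_nonneg (abs_nonneg _) (by linarith))
    have h4 : |ε * ∫ ω, g ω ∂P| / (-∫ ω in A, g ω ∂P) * (∫ ω in A, g ω ∂P)
        = -|ε * ∫ ω, g ω ∂P| := by
      field_simp [hneg.ne]
    rw [h4] at h3
    linarith [le_abs_self (ε * ∫ ω, g ω ∂P)]
  have hg0 : ∀ᵐ ω ∂P, 0 ≤ g ω := by
    set A : Set Ω := {ω | g ω < 0} with hA_def
    have hA : MeasurableSet[sigmaAlg τ] A := hgm.measurable measurableSet_Iio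
    have hA' := sigmaAlg_le τ _ hA
    have h1 : 0 ≤ᵐ[P] A.indicator fun ω => -g ω := Eventually.of_forall fun ω =>
      Set.indicator_nonneg (fun ω (hω : g ω < 0) => by linarith) ω
    have h2 : ∫ ω, A.indicator (fun ω => -g ω) ω ∂P = 0 := by
      refine le_antisymm ?_ (integral_nonneg_of_ae h1)
      rw [integral_indicator hA', integral_neg]
      linarith [hgA A hA]
    rw [integral_eq_zero_iff_of_nonneg_ae h1 (hg.neg.indicator hA')] at h2
    filter_upwards [h2] with ω a1
    by_contra! hω
    rw [Set.indicator_of_mem (show ω ∈ A from hω), Pi.zero_apply] at a1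
    linarith
  have hG : 0 < ∫ ω, g ω ∂P := by
    have h1 := hsep Y₁ hY₁r.le
    rw [hadd Y Y₁ ε hY₁] at h1
    by_contra! hneg
    nlinarith
  set G : ℝ := ∫ ω, g ω ∂P
  have hdiv : ∀ X : Linf P τ, ∫ ω, g ω / G * (X : Lp ℝ ∞ P) ω ∂P
      = (∫ ω, g ω * (X : Lp ℝ ∞ P) ω ∂P) / G := fun X => by
    rw [← integral_div]
    exact integral_congr_ae (Eventually.of_forall fun ω => by simp only; ring)
  refine ⟨fun ω => g ω / G, hg.div_const G,
    (hgm.mono (sigmaAlg_le τ)).measurable.div_const G, ?_, ?_, fun X => ?_⟩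
  · filter_upwards [hg0] with ω a1 using div_nonneg a1 hG.le
  · rw [integral_div, div_self hG.ne']
  · set δ : ℝ := ∫ ω, (ρ.risk h X : Lp ℝ ∞ P) ω ∂P - a
    obtain ⟨X', hX', hX'r⟩ := integral_risk_add_const (ρ := ρ) h X δ
    have h1 := hsep X' (by rw [hX'r]; simp [δ])
    rw [hadd X X' δ hX'] at h1
    rw [hdiv, hdiv]
    have h2 : 0 ≤ (∫ ω, g ω * (X : Lp ℝ ∞ P) ω ∂P + δ * G
        - ∫ ω, g ω * (Y : Lp ℝ ∞ P) ω ∂P) / G := div_nonneg (by linarith) hG.le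
    rw [sub_div, add_div, mul_div_cancel_right₀ _ hG.ne'] at h2
    simp only [δ, ha] at h2
    linarith

theorem ContinuousFromAbove.exists_probability (hρ : ρ.ContinuousFromAbove) (h : ν ≤ τ)
    (Y : Linf P τ) {ε : ℝ} (hε : 0 < ε) :
    ∃ Q : Measure Ω, IsProbabilityMeasure Q ∧ Q ≪ P ∧
      ∀ X : Linf P τ, -∫ ω, (X : Lp ℝ ∞ P) ω ∂Q - ∫ ω, (ρ.risk h X : Lp ℝ ∞ P) ω ∂P ≤
        -∫ ω, (Y : Lp ℝ ∞ P) ω ∂Q - ∫ ω, (ρ.risk h Y : Lp ℝ ∞ P) ω ∂P + ε := by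
  obtain ⟨g, hg, hgm, hg0, hg1, hX⟩ := hρ.exists_density h Y hε
  have hint : ∀ X : Linf P τ, ∫ ω, (X : Lp ℝ ∞ P) ω ∂(P.withDensity fun ω => ENNReal.ofReal (g ω))
      = ∫ ω, g ω * (X : Lp ℝ ∞ P) ω ∂P := fun X => by
    rw [integral_withDensity_eq_integral_toReal_smul hgm.ennreal_ofReal
      (Eventually.of_forall fun ω => ENNReal.ofReal_lt_top)]
    refine integral_congr_ae ?_
    filter_upwards [hg0] with ω a1
    rw [ENNReal.toReal_ofReal a1, smul_eq_mul]
  refine ⟨P.withDensity fun ω => ENNReal.ofReal (g ω), ⟨?_⟩,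
    withDensity_absolutelyContinuous _ _, fun X => ?_⟩
  · rw [withDensity_apply _ MeasurableSet.univ, Measure.restrict_univ,
      ← ofReal_integral_eq_lintegral_ofReal hg hg0, hg1, ENNReal.ofReal_one]
  · rw [hint, hint]
    exact hX X

/-- A probability measure with finite penalty for the expected risk agrees with `P` on `𝓕_ν`: test
the bound against all real multiples of `Z`, on which the risk is affine. -/
theorem integral_eq_of_forall_le (h : ν ≤ τ) {Q : Measure Ω} {K : ℝ}
    (hK : ∀ X : Linf P τ, -∫ ω, (X : Lp ℝ ∞ P) ω ∂Q
      - ∫ ω, (ρ.risk h X : Lp ℝ ∞ P) ω ∂P ≤ K) (hQ : Q ≪ P) (Z : Linf P ν) :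
    ∫ ω, (Z : Lp ℝ ∞ P) ω ∂Q = ∫ ω, (Z : Lp ℝ ∞ P) ω ∂P := by
  have key : ∀ t : ℝ, t * (∫ ω, (Z : Lp ℝ ∞ P) ω ∂P - ∫ ω, (Z : Lp ℝ ∞ P) ω ∂Q)
      ≤ K + ∫ ω, (ρ.risk h 0 : Lp ℝ ∞ P) ω ∂P := by
    intro t
    have h1 := hK (0 + incl P h (t • Z))
    rw [ρ.integral_risk_add, zero_add, coe_incl, integral_congr_ae (Linf.coeFn_smul t Z),
      integral_congr_ae (hQ.ae_le (Linf.coeFn_smul t Z)), integral_const_mul,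
      integral_const_mul] at h1
    linarith
  by_contra hne
  set D : ℝ := ∫ ω, (Z : Lp ℝ ∞ P) ω ∂P - ∫ ω, (Z : Lp ℝ ∞ P) ω ∂Q with hD
  have hD0 : D ≠ 0 := fun h0 => hne (by linarith)
  have h1 := key ((K + ∫ ω, (ρ.risk h 0 : Lp ℝ ∞ P) ω ∂P + 1) / D)
  rw [div_mul_cancel₀ _ hD0] at h1
  linarith

end DynamicRiskMeasure

namespace DynamicRiskMeasure

variable {Ω : Type*} {mΩ : MeasurableSpace Ω} {𝓕 : Filtration ℝ≥0 mΩ} {P : Measure Ω}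
  {ν σ τ : StoppingTime 𝓕} {ρ : DynamicRiskMeasure 𝓕 P} {Q : Measure Ω} [IsProbabilityMeasure Q]

/-! ### From the penalty inequality to time consistency -/

/-- The random variable `E_Q(-X | 𝓕_ν) - ρ_{ν,τ}(X)` of `DynamicRiskMeasure.gap`, with real values.
-/
noncomputable def realGap (ρ : DynamicRiskMeasure 𝓕 P) (h : ν ≤ τ) (Q : Measure Ω)
    (X : Linf P τ) : Ω → ℝ := fun ω =>
  condExp (sigmaAlg ν) Q (fun ω' => -(X : Lp ℝ ∞ P) ω') ω - (ρ.risk h X : Lp ℝ ∞ P) ω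

theorem integrable_realGap (h : ν ≤ τ) (hQ : Q ≪ P) (X : Linf P τ) :
    Integrable (ρ.realGap h Q X) Q :=
  integrable_condExp.sub (integrable_coe hQ _)

theorem expect_penalty_ne_bot (h : ν ≤ τ) (hQ : Q ≪ P) :
    expect Q (ρ.penalty h Q) ≠ ⊥ := by
  have hneg : ∫⁻ ω, (-ρ.penalty h Q ω).toENNReal ∂Q ≠ ∞ := by
    refine ne_top_of_le_ne_top (integrable_realGap (ρ := ρ) h hQ 0).neg.lintegral_lt_top.ne
      (lintegral_mono_ae ?_)
    filter_upwards [ρ.gap_le_penalty h (Q := Q) 0] with ω hω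
    rw [Pi.neg_apply, ← EReal.real_coe_toENNReal]
    refine EReal.toENNReal_le_toENNReal ?_
    rw [EReal.coe_neg, EReal.neg_le_neg_iff]
    exact hω
  rw [expect]
  generalize ∫⁻ ω, (ρ.penalty h Q ω).toENNReal ∂Q = a
  generalize ∫⁻ ω, (-ρ.penalty h Q ω).toENNReal ∂Q = b at *
  lift b to ℝ≥0 using hneg
  rw [Ne, sub_eq_add_neg, EReal.add_eq_bot_iff, not_or]
  exact ⟨EReal.coe_ennreal_ne_bot a, fun h => EReal.coe_ne_top (b : ℝ) (EReal.neg_eq_bot_iff.1 h)⟩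

theorem expect_penalty_ne_top (h : ν ≤ τ) (hQ : Q ≪ P) {K : ℝ}
    (hK : ∀ X, ∫ ω, ρ.realGap h Q X ω ∂Q ≤ K) :
    expect Q (ρ.penalty h Q) ≠ ⊤ := by
  obtain ⟨Y, hY⟩ := ρ.exists_seq_gap_tendsto_penalty h hQ
  obtain ⟨c, hc⟩ := ρ.exists_bound_gap h hQ (Y 0)
  have hpos : ∫⁻ ω, (ρ.penalty h Q ω).toENNReal ∂Q ≤ ENNReal.ofReal (K + |c|) := by
    have h1 : ∀ᵐ ω ∂Q, (ρ.penalty h Q ω).toENNReal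
        = ⨆ n, ENNReal.ofReal (ρ.realGap h Q (Y n) ω) := by
      filter_upwards [hY] with ω a1
      refine tendsto_nhds_unique ((EReal.continuous_toENNReal.tendsto _).comp a1.2)
        (tendsto_atTop_iSup (f := fun n => ENNReal.ofReal (ρ.realGap h Q (Y n) ω)) ?_)
      intro i j hij
      exact EReal.toENNReal_le_toENNReal (a1.1 hij)
    rw [lintegral_congr_ae h1, lintegral_iSup'
      (fun n => (integrable_realGap h hQ (Y n)).aemeasurable.ennreal_ofReal) (by
        filter_upwards [hY] with ω a1 i j hij
        exact EReal.toENNReal_le_toENNReal (a1.1 hij))]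
    refine iSup_le fun n => ?_
    have hi : Integrable (fun ω => ρ.realGap h Q (Y n) ω + |c|) Q :=
      (integrable_realGap h hQ (Y n)).add (integrable_const _)
    have h2 : 0 ≤ᵐ[Q] fun ω => ρ.realGap h Q (Y n) ω + |c| := by
      filter_upwards [hY, hc] with ω a1 a2
      have h3 : ρ.realGap h Q (Y 0) ω ≤ ρ.realGap h Q (Y n) ω :=
        EReal.coe_le_coe_iff.1 (a1.1 n.zero_le)
      have h4 : -c ≤ ρ.realGap h Q (Y 0) ω := (abs_le.1 a2).1
      simp only [Pi.zero_apply]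
      linarith [le_abs_self c]
    calc ∫⁻ ω, ENNReal.ofReal (ρ.realGap h Q (Y n) ω) ∂Q
        ≤ ∫⁻ ω, ENNReal.ofReal (ρ.realGap h Q (Y n) ω + |c|) ∂Q :=
          lintegral_mono fun ω => ENNReal.ofReal_le_ofReal (by linarith [abs_nonneg c])
      _ = ENNReal.ofReal (∫ ω, (ρ.realGap h Q (Y n) ω + |c|) ∂Q) :=
          (ofReal_integral_eq_lintegral_ofReal hi h2).symm
      _ ≤ _ := by
          refine ENNReal.ofReal_le_ofReal ?_
          rw [integral_add (integrable_realGap h hQ (Y n)) (integrable_const _), integral_const]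
          simpa using hK (Y n)
  have hpos' := ne_top_of_le_ne_top ENNReal.ofReal_ne_top hpos
  rw [expect]
  refine ne_top_of_le_ne_top (b := ((∫⁻ ω, (ρ.penalty h Q ω).toENNReal ∂Q : ℝ≥0∞) : EReal)) ?_ ?_
  · simpa using hpos'
  · refine EReal.sub_le_of_le_add ?_
    exact le_add_of_nonneg_right (EReal.coe_ennreal_nonneg _)

/-- By directedness `E_Q(α_{ν,τ}(Q))` is at most the supremum of the expected gaps. The statement in
terms of integrable minorants `w` of the penalty avoids extended expectations. -/
theorem integral_le_of_le_penalty (h : ν ≤ τ) (hQ : Q ≪ P) {K : ℝ}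
    (hK : ∀ X, ∫ ω, ρ.realGap h Q X ω ∂Q ≤ K) {w : Ω → ℝ} (hw : Integrable w Q)
    (hwp : ∀ᵐ ω ∂Q, (w ω : EReal) ≤ ρ.penalty h Q ω) : ∫ ω, w ω ∂Q ≤ K := by
  obtain ⟨Y, hY⟩ := ρ.exists_seq_gap_tendsto_penalty h hQ
  have hint : ∀ n, Integrable (fun ω => min (w ω) (ρ.realGap h Q (Y n) ω)) Q := fun n =>
    hw.inf (integrable_realGap h hQ (Y n))
  have hlim : Tendsto (fun n => ∫ ω, min (w ω) (ρ.realGap h Q (Y n) ω) ∂Q) atTop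
      (𝓝 (∫ ω, w ω ∂Q)) := by
    refine integral_tendsto_of_tendsto_of_monotone hint hw ?_ ?_
    · filter_upwards [hY] with ω a1 i j hij
      exact min_le_min_left _ (EReal.coe_le_coe_iff.1 (a1.1 hij))
    · filter_upwards [hY, hwp] with ω a1 a2
      have h1 : Tendsto (fun n => min (w ω : EReal) (ρ.gap h Q (Y n) ω)) atTop
          (𝓝 (min (w ω : EReal) (ρ.penalty h Q ω))) := tendsto_const_nhds.min a1.2
      rw [min_eq_left a2] at h1
      rw [← EReal.tendsto_coe]
      refine h1.congr fun n => ?_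
      exact (EReal.coe_strictMono.monotone.map_min).symm
  exact le_of_tendsto' hlim fun n =>
    (integral_mono (hint n) (integrable_realGap h hQ (Y n)) fun ω => min_le_right _ _).trans (hK _)

variable [IsProbabilityMeasure P]

theorem integral_realGap_le (h : ν ≤ τ) {K : ℝ} (hQ : Q ≪ P)
    (hK : ∀ X : Linf P τ, -∫ ω, (X : Lp ℝ ∞ P) ω ∂Q
      - ∫ ω, (ρ.risk h X : Lp ℝ ∞ P) ω ∂P ≤ K) (X : Linf P τ) :
    ∫ ω, ρ.realGap h Q X ω ∂Q ≤ K := by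
  have h1 : ∫ ω, ρ.realGap h Q X ω ∂Q = _ :=
    integral_sub integrable_condExp (integrable_coe hQ (ρ.risk h X))
  rw [h1, integral_condExp (sigmaAlg_le ν), integral_neg, integral_eq_of_forall_le h hK hQ]
  exact hK X

/-- If `ρ_{σ,τ}(X) = ρ_{σ,τ}(Y)` then `E_P(ρ_{ν,τ}(Y)) ≤ E_P(ρ_{ν,τ}(X))`. For `Q` almost optimal in
the dual representation at `Y`, the penalty inequality for `X` and
`E_Q(-Y | 𝓕_σ) ≤ ρ_{σ,τ}(Y) + α_{σ,τ}(Q)` give `E_Q(-Y | 𝓕_ν) ≤ ρ_{ν,τ}(X) + α_{ν,τ}(Q)`. The claim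
follows on integrating, as `Q = P` on `𝓕_ν`. -/
theorem integral_risk_le_of_risk_eq (hρ : ρ.ContinuousFromAbove) (hνσ : ν ≤ σ) (hστ : σ ≤ τ)
    {X Y : Linf P τ} (hpen : ∀ (Q : Measure Ω) [IsProbabilityMeasure Q], Q ≪ P →
      expect Q (ρ.penalty (hνσ.trans hστ) Q) ≠ ⊤ → expect Q (ρ.penalty (hνσ.trans hστ) Q) ≠ ⊥ →
      condExpect (sigmaAlg ν) Q
          (fun ω => (((ρ.risk hστ X : Lp ℝ ∞ P) ω : ℝ) : EReal) + ρ.penalty hστ Q ω)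
        ≤ᵐ[Q] fun ω => (((ρ.risk (hνσ.trans hστ) X : Lp ℝ ∞ P) ω : ℝ) : EReal)
          + ρ.penalty (hνσ.trans hστ) Q ω)
    (hXY : ρ.risk hστ X = ρ.risk hστ Y) :
    ∫ ω, (ρ.risk (hνσ.trans hστ) Y : Lp ℝ ∞ P) ω ∂P ≤
      ∫ ω, (ρ.risk (hνσ.trans hστ) X : Lp ℝ ∞ P) ω ∂P := by
  have hντ := hνσ.trans hστ
  refine le_of_forall_pos_le_add fun ε hε => ?_
  obtain ⟨Q, hQp, hQ, hle⟩ := hρ.exists_probability hντ Y hε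
  have hK := integral_realGap_le hντ hQ hle
  have h1 := hpen Q hQ (expect_penalty_ne_top hντ hQ hK) (expect_penalty_ne_bot hντ hQ)
  set u : Ω → ℝ := condExp (sigmaAlg σ) Q (fun ω => -(Y : Lp ℝ ∞ P) ω) with hu
  obtain ⟨c, hc⟩ := exists_bound_condExp_neg (sigmaAlg σ) hQ Y
  have h2 := condExp_le_condExpect (sigmaAlg_le ν) (ρ.measurable_risk_add_penalty (Q := Q) hστ X)
    (u := u) integrable_condExp (hc.mono fun ω hω => (abs_le.1 hω).1) (by
      filter_upwards [ρ.gap_le_penalty hστ (Q := Q) Y] with ω a1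
      rw [hXY]
      refine le_trans (le_of_eq ?_) (add_le_add_right a1 _)
      rw [gap, ← EReal.coe_add, add_sub_cancel])
  set w : Ω → ℝ := fun ω => condExp (sigmaAlg ν) Q (fun ω => -(Y : Lp ℝ ∞ P) ω) ω
    - (ρ.risk hντ X : Lp ℝ ∞ P) ω with hw
  have hwp : ∀ᵐ ω ∂Q, (w ω : EReal) ≤ ρ.penalty hντ Q ω := by
    filter_upwards [h1, h2, condExp_condExp_of_le (μ := Q) (f := fun ω' => -(Y : Lp ℝ ∞ P) ω')
        (sigmaAlg_mono hνσ) (sigmaAlg_le σ)] with ω a1 a2 a3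
    have a4 := a2.trans a1
    rw [hu, a3] at a4
    rw [hw, EReal.coe_sub]
    refine EReal.sub_le_of_le_add ?_
    rwa [add_comm]
  have hwi : Integrable w Q := integrable_condExp.sub (integrable_coe hQ (ρ.risk hντ X))
  have h3 := integral_le_of_le_penalty hντ hQ hK hwi hwp
  have h4 : ∫ ω, w ω ∂Q = _ := integral_sub integrable_condExp (integrable_coe hQ (ρ.risk hντ X))
  rw [h4, integral_condExp (sigmaAlg_le ν), integral_neg,
    integral_eq_of_forall_le hντ hle hQ] at h3
  linarith

/-- The comparison of expected risks localises: apply it to the position equal to `X` on the event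
`{ρ_{ν,τ}(X) < ρ_{ν,τ}(Y)}` and to `Y` elsewhere, whose risk is the minimum of the two. -/
theorem risk_le_of_integral_risk_le (hνσ : ν ≤ σ) (hστ : σ ≤ τ)
    (hint : ∀ X Y : Linf P τ, ρ.risk hστ X = ρ.risk hστ Y →
      ∫ ω, (ρ.risk (hνσ.trans hστ) Y : Lp ℝ ∞ P) ω ∂P ≤
        ∫ ω, (ρ.risk (hνσ.trans hστ) X : Lp ℝ ∞ P) ω ∂P)
    {X Y : Linf P τ} (hXY : ρ.risk hστ X = ρ.risk hστ Y) :
    (ρ.risk (hνσ.trans hστ) Y : Lp ℝ ∞ P) ≤ᵐ[P] (ρ.risk (hνσ.trans hστ) X : Lp ℝ ∞ P) := by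
  have hντ := hνσ.trans hστ
  obtain ⟨x, hx, hXx⟩ := Linf.aestronglyMeasurable (ρ.risk hντ X)
  obtain ⟨y, hy, hYy⟩ := Linf.aestronglyMeasurable (ρ.risk hντ Y)
  set A : Set Ω := {ω | x ω < y ω} with hA_def
  have hA : MeasurableSet[sigmaAlg ν] A := measurableSet_lt hx.measurable hy.measurable
  have hAσ := sigmaAlg_mono hνσ _ hA
  obtain ⟨W, hW1, hW2⟩ := Linf.exists_piecewise (sigmaAlg_mono hντ _ hA) X Y
  have hWY : ρ.risk hστ W = ρ.risk hστ Y := Linf.ext_ae (by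
    filter_upwards [ρ.risk_eq_of_eqOn hστ hAσ hW1, ρ.risk_eq_of_eqOn hστ hAσ.compl hW2]
      with ω a1 a2
    by_cases hω : ω ∈ A
    · rw [a1 hω, hXY]
    · exact a2 hω)
  have h1 := ρ.risk_eq_of_eqOn hντ hA hW1
  have h2 := ρ.risk_eq_of_eqOn hντ hA.compl hW2
  have hle : (ρ.risk hντ W : Lp ℝ ∞ P) ≤ᵐ[P] (ρ.risk hντ Y : Lp ℝ ∞ P) := by
    filter_upwards [h1, h2, hXx, hYy] with ω a1 a2 a3 a4
    by_cases hω : ω ∈ A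
    · rw [a1 hω, a3, a4]
      exact le_of_lt hω
    · exact (a2 hω).le
  have heq := (integral_eq_iff_of_ae_le (integrable_coe_self _) (integrable_coe_self _) hle).1
    (le_antisymm (integral_mono_ae (integrable_coe_self _) (integrable_coe_self _) hle)
      (hint W Y hWY))
  filter_upwards [heq, h1, hXx, hYy] with ω a1 a2 a3 a4
  by_contra! hlt
  have hω : ω ∈ A := by rwa [hA_def, Set.mem_ofPred_eq, ← a3, ← a4]
  rw [← a2 hω, a1] at hlt
  exact lt_irrefl _ hlt

end DynamicRiskMeasure

end DynRisk

theorem proposition1p8 {Ω : Type*} {mΩ : MeasurableSpace Ω} (P : Measure Ω)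
    [IsProbabilityMeasure P] (𝓕 : Filtration ℝ≥0 mΩ) [𝓕.IsRightContinuous]
    (h𝓕 : 𝓕 0 = MeasurableSpace.generateFrom {A : Set Ω | MeasurableSet A ∧ P A = 0})
    (ρ : DynRisk.DynamicRiskMeasure 𝓕 P) (hρ : ρ.ContinuousFromAbove) :
    ρ.TimeConsistent ↔
      ∀ (ν σ τ : DynRisk.StoppingTime 𝓕) (hνσ : ν ≤ σ) (hστ : σ ≤ τ),
        (∀ (Q : Measure Ω) [IsProbabilityMeasure Q], Q ≪ P →
          DynRisk.expect Q (ρ.penalty (hνσ.trans hστ) Q) ≠ ⊤ →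
          DynRisk.expect Q (ρ.penalty (hνσ.trans hστ) Q) ≠ ⊥ →
          ∀ X : DynRisk.Linf P τ,
            DynRisk.condExpect (DynRisk.sigmaAlg ν) Q
                (fun ω => (((ρ.risk hστ X : Lp ℝ ∞ P) ω : ℝ) : EReal) + ρ.penalty hστ Q ω)
              ≤ᵐ[Q] fun ω => (((ρ.risk (hνσ.trans hστ) X : Lp ℝ ∞ P) ω : ℝ) : EReal)
                + ρ.penalty (hνσ.trans hστ) Q ω) ∧
        (∀ Z : DynRisk.Linf P σ,
          ρ.risk hνσ Z =
            ρ.risk (hνσ.trans hστ) (DynRisk.incl P hστ Z + DynRisk.incl P hστ (ρ.risk hστ 0))) := by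
  constructor
  · intro htc ν σ τ hνσ hστ
    exact ⟨fun Q _ hQ _ _ X => htc.condExpect_le hνσ hστ hQ X, htc.risk_eq hνσ hστ⟩
  · intro H ν σ τ hνσ hστ X
    obtain ⟨h1, h2⟩ := H ν σ τ hνσ hστ
    have hint : ∀ X Y : DynRisk.Linf P τ, ρ.risk hστ X = ρ.risk hστ Y →
        ∫ ω, (ρ.risk (hνσ.trans hστ) Y : Lp ℝ ∞ P) ω ∂P ≤
          ∫ ω, (ρ.risk (hνσ.trans hστ) X : Lp ℝ ∞ P) ω ∂P := fun X Y hXY =>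
      DynRisk.DynamicRiskMeasure.integral_risk_le_of_risk_eq hρ hνσ hστ
        (fun Q _ hQ htop hbot => h1 Q hQ htop hbot X) hXY
    -- `-ρ_{σ,τ}(X) + ρ_{σ,τ}(0)` has the same risk at `σ` as `X`; the second property turns the
    -- left-hand side into its risk at `ν`
    have hY : ρ.risk hστ (DynRisk.incl P hστ (-ρ.risk hστ X)
        + DynRisk.incl P hστ (ρ.risk hστ 0)) = ρ.risk hστ X := by
      have h3 := ρ.translation hστ (-ρ.risk hστ X + ρ.risk hστ 0) 0
      rw [zero_add, map_add] at h3
      rw [h3]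
      abel
    rw [h2]
    refine DynRisk.Linf.ext_ae ?_
    filter_upwards [DynRisk.DynamicRiskMeasure.risk_le_of_integral_risk_le hνσ hστ hint hY,
      DynRisk.DynamicRiskMeasure.risk_le_of_integral_risk_le hνσ hστ hint hY.symm] with ω a1 a2
    exact le_antisymm a2 a1
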